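/- An overpartition of $n$ is a partition of $n$ in which one occurrence of each part size that occurs may be overlined. For $n\ge 0$ let $v_0(n)$ denote the number of overpartitions of $n$ into odd parts without gaps between the non-overlined parts; here "without gaps" means that every odd positive integer not exceeding the largest part of the overpartition (overlined or not) occurs at least once as a non-overlined part. (So the non-overlined parts are $1,3,\dots,2k-1$ for some $k\ge 0$, each occurring at least once, the overlined parts are distinct elements of $\{1,3,\dots,2k-1\}$, and $v_0(0)=1$. Equivalently, $\sum_{n\ge0} v_0(n)q^n=\sum_{k\ge0} q^{k^2}\prod_{i=1}^{k}\frac{1+q^{2i-1}}{1-q^{2i-1}}$.) **Theorem.** For all integers $n\ge 0$ and $\alpha\ge 1$, $$v_0(2^{2\alpha+2}n)\equiv\begin{cases}1 \pmod{2^{3\alpha+2}}, & \text{if } n=k^2 \text{ for some integer } k,\\ 0 \pmod{2^{3\alpha+2}}, & \text{otherwise.}\end{cases}$$ -/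

import Mathlib

/-- An overpartition of `n`: a partition of `n` in which, for some of the part sizes that occur,
one occurrence of that size is overlined. -/
@[ext]
structure Overpartition (n : ℕ) where
  /-- the underlying partition, with the overlines forgotten -/
  toPartition : n.Partition
  /-- the set of part sizes one occurrence of which is overlined -/
  overlined : Finset ℕ
  overlined_subset : overlined ⊆ toPartition.parts.toFinset

namespace Overpartition

/-- The multiset of non-overlined parts: one copy of each overlined size is removed. -/
def nonOverlined {n : ℕ} (p : Overpartition n) : Multiset ℕ :=
  p.toPartition.parts - p.overlined.val

/-- All parts, overlined or not, are odd. -/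
def HasOddParts {n : ℕ} (p : Overpartition n) : Prop :=
  ∀ a ∈ p.toPartition.parts, Odd a

/-- For overpartitions into odd parts: there are no gaps between the non-overlined parts.  Every
odd number up to the largest part of the overpartition occurs as a non-overlined part.  So the
non-overlined parts are `1, 3, …, 2k - 1`, each with multiplicity at least one, for some `k ≥ 0`,
and the overlined parts, which are distinct, lie in `{1, 3, …, 2k - 1}`.  These are the
overpartitions that the summand `q^(k^2) (-q; q^2)_k / (q; q^2)_k` generates. -/
def HasNoGaps {n : ℕ} (p : Overpartition n) : Prop :=
  ∀ a ∈ p.toPartition.parts, ∀ b ≤ a, Odd b → b ∈ p.nonOverlined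

/-- Choosing an overpartition is choosing a partition and a subset of the set of its parts. -/
def equivSigma (n : ℕ) :
    (Σ p : n.Partition, {s : Finset ℕ // s ∈ p.parts.toFinset.powerset}) ≃ Overpartition n where
  toFun x := ⟨x.1, x.2.1, Finset.mem_powerset.1 x.2.2⟩
  invFun p := ⟨p.toPartition, p.overlined, Finset.mem_powerset.2 p.overlined_subset⟩
  left_inv _ := rfl
  right_inv _ := rfl

instance (n : ℕ) : Fintype (Overpartition n) := Fintype.ofEquiv _ (equivSigma n)

instance {n : ℕ} (p : Overpartition n) : Decidable p.HasOddParts := by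
  unfold HasOddParts; infer_instance

instance {n : ℕ} (p : Overpartition n) : Decidable p.HasNoGaps := by
  unfold HasNoGaps; infer_instance

end Overpartition

/-- `v₀(n)`: the number of overpartitions of `n` into odd parts without gaps between the
non-overlined parts. -/
def v₀ (n : ℕ) : ℕ :=
  Fintype.card {p : Overpartition n // p.HasOddParts ∧ p.HasNoGaps}

/-!
Write `φ(q) = ∑_{n ∈ ℤ} q^(n²)` and `V(q) = ∑ v₀(n) qⁿ = ∑ₖ q^(k²) (-q; q²)ₖ / (q; q²)ₖ`.

**Reduction to theta series.**  Replacing `k` by `-k` in the summand turns `V(q)` into `V(-q)`, so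
`V(q) + V(-q) - 1` is the bilateral sum over `k ∈ ℤ`.  Multiplied by `(q; q²)_∞ (-q; q²)_∞`, its
`n`-th term becomes a product of two Euler series `∑ᵢ (±1)ⁱ q^((i ± n)²) / (q²; q²)ᵢ`
(`eulerShift`).  In the resulting triple sum over `(n, i, j)` the exponent
`(i + n)² + (j - n)²` depends only on `u = i + n` and `N = i + j`, and for fixed `u` and `N` the sum
over `i` is Gauss's alternating sum `∑_{i+j=N} (-1)ⁱ / ((q²; q²)ᵢ (q²; q²)ⱼ)`, which vanishes for odd
`N` and equals `1 / (q⁴; q⁴)_M` for `N = 2M`.  This yields `hasSum_eulerShift_mul_eulerShift`; its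
variant with a second sign gives `φ(q) (q; q²)_∞² = φ(-q²) (q²; q⁴)_∞`, which removes the infinite
products without the triple product identity.  The outcome is
`(V(q) + V(-q) - 1) φ(-q⁴) = φ(q²)²` (`v₀_even_part_mul_theta`), and taking even parts once more,
`φ(-q) ∑ (2 v₀(4n) - [n = 0]) qⁿ = φ(q)²` (`theta_neg_mul_quarterSeries`).

**Iteration.**  Let `U` send `∑ aₙ qⁿ` to `∑ a₄ₙ qⁿ`, and let `t = φ(q)⁴ / φ(-q)⁴ - 1`, which is
divisible by `16`.  Split `φ = P + Q` into its even and odd parts.  Then `P = φ(q⁴)`,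
`Q⁴ = φ(q⁴)⁴ - φ(-q⁴)⁴`, and the exponents in `Q` are `1` modulo `4`, so `U` is explicit on
polynomials in `P` and `Q`.  As `t φ(-q⁴)¹⁶ = 8 P Q (P² + Q²)⁵ (P + Q)⁴`, the operator `U` maps
`φ tᵏ`, for `k ≥ 1`, into `8ᵏ` times the span of the `φ tʲ` with `j ≥ 1`.  Moreover `U φ = φ`, and
`U` maps the series `φ(q)² / φ(-q)` to `φ + 4 φ t`.  Hence its `α`-th iterate is `φ` plus `2^(3α-1)`
times an element of that span, that is, `φ` modulo `2^(3α+3)`; comparing coefficients and dividing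
by two gives the congruences.
-/

section

open PowerSeries
open scoped PowerSeries.WithPiTopology

/-! ### Summability, signs and `q`-factorials -/

theorem summable_X_pow_mul {ι : Type*} (e : ι → ℕ) (g : ι → ℤ⟦X⟧)
    (h : ∀ d, {i | e i ≤ d}.Finite) : Summable fun i ↦ X ^ e i * g i := by
  rw [WithPiTopology.summable_iff_summable_coeff]
  refine fun d ↦ summable_of_hasFiniteSupport ((h d).subset fun i hi ↦ ?_)
  by_contra hlt
  exact hi (by simp_all [coeff_X_pow_mul'])

/-- A sign, as a constant power series. -/
noncomputable def sgn (u : ℤˣ) : ℤ⟦X⟧ := ((u : ℤ) : ℤ⟦X⟧)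

@[simp] theorem sgn_one : sgn 1 = 1 := by simp [sgn]

@[simp] theorem sgn_neg (u : ℤˣ) : sgn (-u) = -sgn u := by simp [sgn]

theorem sgn_mul (u v : ℤˣ) : sgn (u * v) = sgn u * sgn v := by simp [sgn]

theorem sgn_pow (u : ℤˣ) (n : ℕ) : sgn (u ^ n) = sgn u ^ n := by simp [sgn]

theorem sgn_mul_self (u : ℤˣ) : sgn u * sgn u = 1 := by
  rw [← sgn_mul, Int.units_mul_self, sgn_one]

/-- The reciprocal `1 / (q²; q²)ᵢ` of a `q`-shifted factorial. -/
noncomputable def invPoch : ℕ → ℤ⟦X⟧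
  | 0 => 1
  | i + 1 => invPoch i * invOfUnit (1 - X ^ (2 * (i + 1))) 1

theorem one_sub_X_pow_mul_invPoch_succ (i : ℕ) :
    (1 - X ^ (2 * (i + 1))) * invPoch (i + 1) = invPoch i := by
  rw [invPoch, mul_left_comm, mul_invOfUnit _ _ (by simp), mul_one]

theorem one_sub_X_pow_ne_zero {m : ℕ} (hm : m ≠ 0) : (1 - X ^ m : ℤ⟦X⟧) ≠ 0 := fun h ↦ by
  simpa [hm] using congrArg constantCoeff h

/-! ### Shifted Euler series -/

theorem finite_natAbs_add_sq_le (n : ℤ) (d : ℕ) :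
    {i : ℕ | ((i : ℤ) + n).natAbs ^ 2 ≤ d}.Finite := by
  refine (Set.finite_Iic (d + n.natAbs)).subset fun i hi ↦ ?_
  have h : ((i : ℤ) + n).natAbs ≤ d := (Nat.le_self_pow two_ne_zero _).trans hi
  simp only [Set.mem_Iic]
  omega

/-- The `i`-th term of `eulerShift ε n`. -/
noncomputable def eulerShiftTerm (ε : ℤˣ) (n : ℤ) (i : ℕ) : ℤ⟦X⟧ :=
  X ^ (((i : ℤ) + n).natAbs ^ 2) * (sgn ε ^ i * invPoch i)

/-- The series `∑ᵢ εⁱ q^((i+n)²) / (q²; q²)ᵢ`.  It is `q^(n²)` times Euler's expansion of the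
infinite product `(-ε q^(2n+1); q²)_∞`. -/
noncomputable def eulerShift (ε : ℤˣ) (n : ℤ) : ℤ⟦X⟧ := ∑' i, eulerShiftTerm ε n i

theorem hasSum_eulerShift (ε : ℤˣ) (n : ℤ) :
    HasSum (eulerShiftTerm ε n) (eulerShift ε n) :=
  (summable_X_pow_mul _ _ (finite_natAbs_add_sq_le n)).hasSum

/-- Euler's functional equation `F(z) = (1 + ε z q) F(z q²)` at `z = q^(2n)`.  The exponents `s` and `t`
clear denominators, so that positive and negative `n` are covered together. -/
theorem eulerShift_step (ε : ℤˣ) {n : ℤ} {s t : ℕ} (h : (s : ℤ) - t = 2 * n + 1) :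
    X ^ s * eulerShift ε n = (X ^ t + sgn ε * X ^ s) * eulerShift ε (n + 1) := by
  have hf := ((hasSum_eulerShift ε n).mul_left (X ^ s)).sub
    ((hasSum_eulerShift ε (n + 1)).mul_left (X ^ t))
  have h1 := (hasSum_nat_add_iff' 1).2 hf
  have h2 := (hasSum_eulerShift ε (n + 1)).mul_left (sgn ε * X ^ s)
  have h0 : X ^ s * eulerShiftTerm ε n 0 - X ^ t * eulerShiftTerm ε (n + 1) 0 = 0 := by
    simp only [eulerShiftTerm, ← mul_assoc, ← pow_add]
    rw [sub_eq_zero]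
    congr 3
    zify
    simp only [sq_abs, zero_add]
    linear_combination h
  have h3 : ∀ i, X ^ s * eulerShiftTerm ε n (i + 1) - X ^ t * eulerShiftTerm ε (n + 1) (i + 1) =
      sgn ε * X ^ s * eulerShiftTerm ε (n + 1) i := fun i ↦ by
    simp only [eulerShiftTerm]
    rw [← one_sub_X_pow_mul_invPoch_succ i]
    have e1 : t + (((i + 1 : ℕ) : ℤ) + (n + 1)).natAbs ^ 2 =
        s + ((i : ℤ) + (n + 1)).natAbs ^ 2 + 2 * (i + 1) := by
      zify
      simp only [sq_abs]
      linear_combination -h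
    have e2 : ((i + 1 : ℕ) : ℤ) + n = (i : ℤ) + (n + 1) := by push_cast; ring
    rw [← mul_assoc (X ^ t), ← pow_add, e1, e2, pow_add, pow_add, pow_succ]
    ring
  simp only [h3, Finset.sum_range_one, h0, sub_zero] at h1
  linear_combination h1.unique h2

/-- The finite product `(-ε q; q²)ₘ`. -/
noncomputable def oddProd (ε : ℤˣ) (m : ℕ) : ℤ⟦X⟧ :=
  ∏ i ∈ Finset.range m, (1 + sgn ε * X ^ (2 * i + 1))

theorem constantCoeff_oddProd (ε : ℤˣ) (m : ℕ) : constantCoeff (oddProd ε m) = 1 := by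
  simp [oddProd, map_prod]

theorem oddProd_ne_zero (ε : ℤˣ) (m : ℕ) : oddProd ε m ≠ 0 := fun h ↦ by
  simpa [constantCoeff_oddProd] using congrArg constantCoeff h

/-- Euler's functional equation iterated towards positive shifts. -/
theorem oddProd_mul_eulerShift (ε : ℤˣ) (m : ℕ) :
    oddProd ε m * eulerShift ε m = X ^ (m ^ 2) * eulerShift ε 0 := by
  induction m with
  | zero => simp [oddProd]
  | succ m ih =>
    have h := eulerShift_step ε (n := m) (s := 2 * m + 1) (t := 0) (by push_cast; ring)
    rw [oddProd, Finset.prod_range_succ, ← oddProd]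
    push_cast
    rw [pow_zero] at h
    rw [mul_assoc, ← h, show (m + 1) ^ 2 = 2 * m + 1 + m ^ 2 by ring, pow_add]
    linear_combination X ^ (2 * m + 1) * ih

/-- Euler's functional equation iterated towards negative shifts. -/
theorem sgn_pow_mul_eulerShift_neg (ε : ℤˣ) (m : ℕ) :
    sgn (ε ^ m) * eulerShift ε (-m) = oddProd ε m * eulerShift ε 0 := by
  induction m with
  | zero => simp [oddProd]
  | succ m ih =>
    have h := eulerShift_step ε (n := -(m + 1)) (s := 0) (t := 2 * m + 1) (by push_cast; ring)
    rw [show -((m : ℤ) + 1) + 1 = -m by ring, pow_zero] at h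
    rw [oddProd, Finset.prod_range_succ, ← oddProd]
    push_cast
    rw [pow_succ, sgn_mul]
    rw [one_mul] at h
    linear_combination sgn (ε ^ m) * sgn ε * h + (1 + sgn ε * X ^ (2 * m + 1)) * ih
      + sgn (ε ^ m) * eulerShift ε (-m) * sgn_mul_self ε

/-! ### Gauss's alternating sum -/

/-- The sum `∑_{i+j=N} (-1)ⁱ / ((q²; q²)ᵢ (q²; q²)ⱼ)`. -/
noncomputable def altInvPochSum (N : ℕ) : ℤ⟦X⟧ :=
  ∑ x ∈ Finset.HasAntidiagonal.antidiagonal N, (-1) ^ x.1 * invPoch x.1 * invPoch x.2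

theorem altInvPochSum_add_two (N : ℕ) :
    (1 - X ^ (2 * (N + 2))) * altInvPochSum (N + 2) = altInvPochSum N := by
  -- `1 - q^(2(i+j)) = (1 - q^(2i)) + q^(2i) (1 - q^(2j))` lowers one of the two indices
  set h : ℕ → ℤ⟦X⟧ := fun N ↦
    ∑ x ∈ Finset.HasAntidiagonal.antidiagonal N, (-1) ^ x.1 * X ^ (2 * x.1) * invPoch x.1 * invPoch x.2 with hh
  have lower : ∀ i, X ^ (2 * (i + 1)) * invPoch (i + 1) = invPoch (i + 1) - invPoch i := fun i ↦ by
    linear_combination -one_sub_X_pow_mul_invPoch_succ i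
  have h1 : ∀ N, h (N + 1) = altInvPochSum (N + 1) + altInvPochSum N := fun N ↦ by
    simp only [hh, altInvPochSum, Finset.Nat.antidiagonal_succ, Finset.sum_cons, Finset.sum_map,
      Function.Embedding.coe_prodMap, Prod.map, Function.Embedding.coeFn_mk,
      Function.Embedding.refl_apply, pow_zero, Nat.succ_eq_add_one, mul_zero]
    rw [add_assoc, ← Finset.sum_add_distrib]
    refine congrArg₂ (· + ·) (by ring) (Finset.sum_congr rfl fun x _ ↦ ?_)
    linear_combination (-1) ^ (x.1 + 1) * invPoch x.2 * lower x.1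
  have h2 : ∀ N, (1 - X ^ (2 * (N + 1))) * altInvPochSum (N + 1) = h N - altInvPochSum N := fun N ↦ by
    have e1 : ∑ x ∈ Finset.HasAntidiagonal.antidiagonal (N + 1),
        (-1 : ℤ⟦X⟧) ^ x.1 * (1 - X ^ (2 * x.1)) * invPoch x.1 * invPoch x.2 = -altInvPochSum N := by
      simp only [altInvPochSum, Finset.Nat.antidiagonal_succ, Finset.sum_cons, Finset.sum_map,
        Function.Embedding.coe_prodMap, Prod.map, Function.Embedding.coeFn_mk,
        Function.Embedding.refl_apply, pow_zero, Nat.succ_eq_add_one, mul_zero, sub_self, zero_mul,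
        zero_add, ← Finset.sum_neg_distrib]
      refine Finset.sum_congr rfl fun x _ ↦ ?_
      linear_combination (-1) ^ (x.1 + 1) * invPoch x.2 * one_sub_X_pow_mul_invPoch_succ x.1
    have e2 : ∑ x ∈ Finset.HasAntidiagonal.antidiagonal (N + 1),
        (-1) ^ x.1 * X ^ (2 * x.1) * invPoch x.1 * ((1 - X ^ (2 * x.2)) * invPoch x.2) = h N := by
      simp only [hh, Finset.Nat.antidiagonal_succ', Finset.sum_cons, Finset.sum_map,
        Function.Embedding.coe_prodMap, Prod.map, Function.Embedding.coeFn_mk,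
        Function.Embedding.refl_apply, pow_zero, Nat.succ_eq_add_one, mul_zero, sub_self, zero_mul,
        zero_add, one_sub_X_pow_mul_invPoch_succ]
    rw [sub_eq_neg_add (h N), ← e1, ← e2, altInvPochSum, Finset.mul_sum, ← Finset.sum_add_distrib]
    refine Finset.sum_congr rfl fun x hx ↦ ?_
    rw [← Finset.HasAntidiagonal.mem_antidiagonal.1 hx, mul_add, pow_add]
    ring
  rw [show N + 2 = N + 1 + 1 from rfl, h2, h1]
  ring

theorem altInvPochSum_two_mul_add_one (M : ℕ) : altInvPochSum (2 * M + 1) = 0 := by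
  induction M with
  | zero => simp [altInvPochSum, Finset.Nat.antidiagonal_succ, mul_comm]
  | succ M ih =>
    have h := altInvPochSum_add_two (2 * M + 1)
    rw [ih] at h
    exact (mul_eq_zero.1 h).resolve_left (one_sub_X_pow_ne_zero (by omega))

theorem altInvPochSum_two_mul (M : ℕ) :
    altInvPochSum (2 * M) = expand 2 two_ne_zero (invPoch M) := by
  induction M with
  | zero => simp [altInvPochSum, invPoch]
  | succ M ih =>
    have h := altInvPochSum_add_two (2 * M)
    rw [ih, ← one_sub_X_pow_mul_invPoch_succ M, map_mul] at h
    have e : expand 2 two_ne_zero (1 - X ^ (2 * (M + 1)) : ℤ⟦X⟧) = 1 - X ^ (2 * (2 * M + 2)) := by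
      rw [map_sub, map_one, map_pow, expand_X, ← pow_mul]
      congr 2
    rw [e] at h
    exact mul_left_cancel₀ (one_sub_X_pow_ne_zero (by omega)) h

/-! ### Theta series -/

theorem hasSum_expand {ι : Type*} {f : ι → ℤ⟦X⟧} {s : ℤ⟦X⟧} (k : ℕ) (hk : k ≠ 0)
    (h : HasSum f s) : HasSum (fun i ↦ expand k hk (f i)) (expand k hk s) := by
  rw [WithPiTopology.hasSum_iff_hasSum_coeff] at h ⊢
  intro d
  by_cases hd : k ∣ d
  · obtain ⟨m, rfl⟩ := hd
    simpa only [coeff_expand_mul] using h m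
  · simpa only [coeff_expand_of_not_dvd _ _ _ hd] using hasSum_zero

theorem hasSum_rescale {ι : Type*} {f : ι → ℤ⟦X⟧} {s : ℤ⟦X⟧} (a : ℤ)
    (h : HasSum f s) : HasSum (fun i ↦ rescale a (f i)) (rescale a s) := by
  rw [WithPiTopology.hasSum_iff_hasSum_coeff] at h ⊢
  intro d
  simpa only [coeff_rescale] using (h d).mul_left (a ^ d)

theorem finite_mul_natAbs_sq_le {k : ℕ} (hk : k ≠ 0) (d : ℕ) :
    {n : ℤ | k * n.natAbs ^ 2 ≤ d}.Finite := by
  refine (Set.finite_Icc (-d : ℤ) d).subset fun n hn ↦ ?_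
  have h : n.natAbs ≤ d := ((Nat.le_self_pow two_ne_zero _).trans
    (Nat.le_mul_of_pos_left _ (Nat.pos_of_ne_zero hk))).trans hn
  simp only [Set.mem_Icc]
  omega

/-- The theta series `∑_{n ∈ ℤ} εⁿ q^(k n²)`; it is meaningful for `k ≠ 0`. -/
noncomputable def theta (ε : ℤˣ) (k : ℕ) : ℤ⟦X⟧ := ∑' n : ℤ, X ^ (k * n.natAbs ^ 2) * sgn (ε ^ n)

theorem hasSum_theta (ε : ℤˣ) {k : ℕ} (hk : k ≠ 0) :
    HasSum (fun n : ℤ ↦ X ^ (k * n.natAbs ^ 2) * sgn (ε ^ n)) (theta ε k) :=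
  (summable_X_pow_mul _ _ (finite_mul_natAbs_sq_le hk)).hasSum

theorem expand_sgn (k : ℕ) (hk : k ≠ 0) (u : ℤˣ) : expand k hk (sgn u) = sgn u := by
  simp [sgn]

theorem expand_theta (ε : ℤˣ) (m : ℕ) (hm : m ≠ 0) {k : ℕ} (hk : k ≠ 0) :
    expand m hm (theta ε k) = theta ε (m * k) := by
  refine (hasSum_expand m hm (hasSum_theta ε hk)).unique ?_
  convert hasSum_theta ε (mul_ne_zero hm hk) using 2 with n
  rw [map_mul, map_pow, expand_X, expand_sgn, ← pow_mul, mul_assoc]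

theorem neg_one_pow_natAbs_sq (n : ℤ) : (-1 : ℤˣ) ^ (n.natAbs ^ 2) = (-1) ^ n := by
  obtain ⟨m, rfl | rfl⟩ := n.eq_nat_or_neg
  · rw [Int.natAbs_natCast, zpow_natCast]
    rcases Nat.even_or_odd m with h | h
    · rw [h.neg_one_pow, (h.pow_of_ne_zero two_ne_zero).neg_one_pow]
    · rw [h.neg_one_pow, h.pow.neg_one_pow]
  · rw [Int.natAbs_neg, Int.natAbs_natCast, zpow_neg, zpow_natCast, Int.units_inv_eq_self]
    rcases Nat.even_or_odd m with h | h
    · rw [h.neg_one_pow, (h.pow_of_ne_zero two_ne_zero).neg_one_pow]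
    · rw [h.neg_one_pow, h.pow.neg_one_pow]

theorem rescale_neg_one_X_pow (m : ℕ) :
    rescale (-1 : ℤ) (X ^ m) = X ^ m * sgn ((-1) ^ m) := by
  rw [map_pow, rescale_X, mul_pow, sgn_pow, mul_comm]
  simp

theorem rescale_neg_one_sgn (u : ℤˣ) : rescale (-1 : ℤ) (sgn u) = sgn u := by
  simp [sgn]

theorem rescale_neg_one_theta (ε : ℤˣ) : rescale (-1 : ℤ) (theta ε 1) = theta (-ε) 1 := by
  refine (hasSum_rescale (-1) (hasSum_theta ε one_ne_zero)).unique ?_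
  convert hasSum_theta (-ε) one_ne_zero using 2 with n
  rw [map_mul, rescale_neg_one_X_pow, rescale_neg_one_sgn, one_mul, neg_one_pow_natAbs_sq, mul_assoc,
    ← sgn_mul, ← mul_zpow, neg_one_mul]

theorem rescale_neg_one_invPoch (i : ℕ) : rescale (-1 : ℤ) (invPoch i) = invPoch i := by
  induction i with
  | zero => simp [invPoch]
  | succ i ih =>
    have h := congrArg (rescale (-1 : ℤ)) (one_sub_X_pow_mul_invPoch_succ i)
    rw [ih, ← one_sub_X_pow_mul_invPoch_succ i, map_mul, map_sub, map_one, rescale_neg_one_X_pow,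
      (even_two_mul _).neg_one_pow, sgn_one, mul_one] at h
    exact mul_left_cancel₀ (one_sub_X_pow_ne_zero (by omega)) h

theorem rescale_neg_one_eulerShift_zero (ε : ℤˣ) :
    rescale (-1 : ℤ) (eulerShift ε 0) = eulerShift (-ε) 0 := by
  refine (hasSum_rescale (-1) (hasSum_eulerShift ε 0)).unique ?_
  convert hasSum_eulerShift (-ε) 0 using 2 with n
  rw [eulerShiftTerm, eulerShiftTerm, map_mul, map_mul, rescale_neg_one_X_pow,
    map_pow, rescale_neg_one_sgn, rescale_neg_one_invPoch, neg_one_pow_natAbs_sq, add_zero, zpow_natCast,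
    sgn_pow, sgn_neg, sgn_neg, neg_pow (sgn ε), sgn_one]
  ring

theorem constantCoeff_theta (ε : ℤˣ) {k : ℕ} (hk : k ≠ 0) : constantCoeff (theta ε k) = 1 := by
  have h := ((WithPiTopology.hasSum_iff_hasSum_coeff ℤ).1 (hasSum_theta ε hk)) 0
  rw [← coeff_zero_eq_constantCoeff_apply]
  refine h.unique ?_
  convert hasSum_single (0 : ℤ) fun n hn ↦ ?_ using 1
  · simp
  · simp [hk, hn]

theorem constantCoeff_eulerShift_zero (ε : ℤˣ) : constantCoeff (eulerShift ε 0) = 1 := by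
  have h := ((WithPiTopology.hasSum_iff_hasSum_coeff ℤ).1 (hasSum_eulerShift ε 0)) 0
  rw [← coeff_zero_eq_constantCoeff_apply]
  refine h.unique ?_
  convert hasSum_single (0 : ℕ) fun n hn ↦ ?_ using 1
  · simp [eulerShiftTerm, invPoch]
  · simp [eulerShiftTerm, hn]

theorem theta_ne_zero (ε : ℤˣ) {k : ℕ} (hk : k ≠ 0) : theta ε k ≠ 0 := fun h ↦ by
  simpa [constantCoeff_theta ε hk] using congrArg constantCoeff h

theorem eulerShift_zero_ne_zero (ε : ℤˣ) : eulerShift ε 0 ≠ 0 := fun h ↦ by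
  simpa [constantCoeff_eulerShift_zero] using congrArg constantCoeff h

/-- `HasSum.mul` with the instances on power series fixed, which spares a costly unification. -/
theorem hasSum_mul {ι κ : Type*} {f : ι → ℤ⟦X⟧} {g : κ → ℤ⟦X⟧} {s t : ℤ⟦X⟧} (hf : HasSum f s)
    (hg : HasSum g t) (hfg : Summable fun x : ι × κ ↦ f x.1 * g x.2) :
    HasSum (fun x : ι × κ ↦ f x.1 * g x.2) (s * t) :=
  hf.mul hg hfg

/-! ### A bilateral sum of products of Euler series -/

/-- The change of summation variables `(n, i, j) ↦ (i + n, i + j)`, with fibres the antidiagonals. -/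
def shearEquiv :
    (Σ p : ℤ × ℕ, Finset.HasAntidiagonal.antidiagonal p.2) ≃ ℤ × ℕ × ℕ where
  toFun x := (x.1.1 - x.2.1.1, x.2.1)
  invFun y := ⟨(y.2.1 + y.1, y.2.1 + y.2.2), ⟨y.2, Finset.HasAntidiagonal.mem_antidiagonal.2 rfl⟩⟩
  left_inv := by
    rintro ⟨⟨u, N⟩, ⟨⟨i, j⟩, h⟩⟩
    obtain rfl := Finset.HasAntidiagonal.mem_antidiagonal.1 h
    simp
  right_inv := by
    rintro ⟨n, i, j⟩
    simp

theorem finite_sq_add_sq_le (d : ℕ) :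
    {x : ℤ × ℕ × ℕ | ((x.2.1 : ℤ) + x.1).natAbs ^ 2 + ((x.2.2 : ℤ) + -x.1).natAbs ^ 2 ≤ d}.Finite := by
  refine ((Set.finite_Icc (-(3 * d) : ℤ) (3 * d)).prod
    ((Set.finite_Iic (2 * d)).prod (Set.finite_Iic (2 * d)))).subset fun ⟨n, i, j⟩ h ↦ ?_
  simp only [Set.mem_ofPred_eq] at h
  have h1 := (Nat.le_self_pow two_ne_zero ((i : ℤ) + n).natAbs)
  have h2 := (Nat.le_self_pow two_ne_zero ((j : ℤ) + -n).natAbs)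
  simp only [Set.mem_prod, Set.mem_Icc, Set.mem_Iic]
  omega

/-- The term `(n, i, j)` of the triple sum over `ℤ × ℕ × ℕ` obtained by expanding the two Euler
series in `∑ₙ εⁿ eulerShift (-1) n * eulerShift ε (-n)`. -/
noncomputable def tripleTerm (ε : ℤˣ) (x : ℤ × ℕ × ℕ) : ℤ⟦X⟧ :=
  eulerShiftTerm (-1) x.1 x.2.1 * (sgn (ε ^ x.1) * eulerShiftTerm ε (-x.1) x.2.2)

theorem tripleTerm_eq (ε : ℤˣ) (x : ℤ × ℕ × ℕ) : tripleTerm ε x =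
    X ^ (((x.2.1 : ℤ) + x.1).natAbs ^ 2 + ((x.2.2 : ℤ) + -x.1).natAbs ^ 2) *
      ((-1) ^ x.2.1 * (sgn (ε ^ x.1) * sgn ε ^ x.2.2) * invPoch x.2.1 * invPoch x.2.2) := by
  simp only [tripleTerm, eulerShiftTerm, sgn_neg, sgn_one]
  ring

theorem summable_tripleTerm (ε : ℤˣ) : Summable (tripleTerm ε) := by
  rw [funext (tripleTerm_eq ε)]
  exact summable_X_pow_mul _ _ finite_sq_add_sq_le

theorem hasSum_tripleTerm_rows (ε : ℤˣ) :
    HasSum (fun n : ℤ ↦ eulerShift (-1) n * (sgn (ε ^ n) * eulerShift ε (-n)))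
      (∑' x, tripleTerm ε x) := by
  refine (summable_tripleTerm ε).hasSum.prod_fiberwise fun n ↦ ?_
  have hs : Summable fun y : ℕ × ℕ ↦ tripleTerm ε (n, y) :=
    (summable_tripleTerm ε).comp_injective (Prod.mk_right_injective n)
  have e : (fun y : ℕ × ℕ ↦ tripleTerm ε (n, y)) = fun y ↦
    eulerShiftTerm (-1) n y.1 * (sgn (ε ^ n) * eulerShiftTerm ε (-n) y.2) := rfl
  rw [e] at hs ⊢
  have h := hasSum_mul (hasSum_eulerShift (-1) n)
    ((hasSum_eulerShift ε (-n)).mul_left (sgn (ε ^ n)))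
  exact h hs

/-- The sum of `tripleTerm ε` over a fibre of `shearEquiv`. -/
noncomputable def shearTerm (ε : ℤˣ) (p : ℤ × ℕ) : ℤ⟦X⟧ :=
  X ^ (p.1.natAbs ^ 2 + ((p.2 : ℤ) - p.1).natAbs ^ 2) * (sgn (ε ^ (p.1 + p.2)) * altInvPochSum p.2)

theorem shearTerm_eq_sum (ε : ℤˣ) (p : ℤ × ℕ) : shearTerm ε p =
    ∑ y ∈ Finset.HasAntidiagonal.antidiagonal p.2, tripleTerm ε (p.1 - y.1, y) := by
  simp only [shearTerm, altInvPochSum, Finset.mul_sum]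
  refine Finset.sum_congr rfl fun y hy ↦ ?_
  rw [tripleTerm_eq]
  have hy := Finset.HasAntidiagonal.mem_antidiagonal.1 hy
  have e1 : ((y.1 : ℤ) + (p.1 - y.1)) = p.1 := by ring
  have e2 : ((y.2 : ℤ) + -(p.1 - y.1)) = p.2 - p.1 := by rw [← hy]; push_cast; ring
  have e3 : sgn (ε ^ (p.1 + p.2)) = sgn (ε ^ (p.1 - y.1)) * sgn ε ^ y.2 := by
    rw [← sgn_pow, ← sgn_mul, ← zpow_natCast, ← zpow_add, ← hy,
      show p.1 + ((y.1 + y.2 : ℕ) : ℤ) = p.1 - y.1 + y.2 + 2 * y.1 by push_cast; ring, zpow_add,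
      zpow_mul, zpow_ofNat, Int.units_sq, one_zpow, mul_one]
  simp only [e1, e2, e3]
  ring

theorem hasSum_shearTerm (ε : ℤˣ) : HasSum (shearTerm ε) (∑' x, tripleTerm ε x) := by
  refine ((shearEquiv.hasSum_iff).2 (summable_tripleTerm ε).hasSum).sigma fun p ↦ ?_
  rw [shearTerm_eq_sum]
  exact Finset.hasSum (Finset.HasAntidiagonal.antidiagonal p.2)
    (fun y : ℕ × ℕ ↦ tripleTerm ε (p.1 - y.1, y))

theorem shearTerm_even (ε : ℤˣ) (v : ℤ) (M : ℕ) : shearTerm ε (v + M, 2 * M) =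
    (X ^ (2 * v.natAbs ^ 2) * sgn (ε ^ v)) * expand 2 two_ne_zero (eulerShiftTerm ε 0 M) := by
  have e1 : (v + M).natAbs ^ 2 + (((2 * M : ℕ) : ℤ) - (v + M)).natAbs ^ 2 =
      2 * v.natAbs ^ 2 + 2 * ((M : ℤ) + 0).natAbs ^ 2 := by
    zify
    simp only [sq_abs]
    ring
  have e2 : sgn (ε ^ (v + M + ((2 * M : ℕ) : ℤ))) = sgn (ε ^ v) * sgn ε ^ M := by
    rw [zpow_add, zpow_natCast, pow_mul, Int.units_sq, one_pow, mul_one, zpow_add, zpow_natCast,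
      sgn_mul, sgn_pow]
  simp only [shearTerm]
  rw [e1, e2, altInvPochSum_two_mul, eulerShiftTerm, map_mul, map_mul, map_pow, map_pow, expand_X,
    expand_sgn, pow_add, ← pow_mul]
  ring

/-- Summing over `n` first for fixed `i + j` turns the sum over `i` and `j` into Gauss's alternating
sum, which leaves a theta series times Euler's series in `q²`. -/
theorem hasSum_eulerShift_mul_eulerShift (ε : ℤˣ) :
    HasSum (fun n : ℤ ↦ eulerShift (-1) n * (sgn (ε ^ n) * eulerShift ε (-n)))
      (theta ε 2 * expand 2 two_ne_zero (eulerShift ε 0)) := by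
  have hinj : Function.Injective fun x : ℤ × ℕ ↦ ((x.1 + x.2, 2 * x.2) : ℤ × ℕ) := by
    rintro ⟨v, M⟩ ⟨v', M'⟩ h
    simp only [Prod.mk.injEq] at h
    ext <;> simp only <;> omega
  have hodd : ∀ x ∉ Set.range fun x : ℤ × ℕ ↦ ((x.1 + x.2, 2 * x.2) : ℤ × ℕ),
      shearTerm ε x = 0 := by
    rintro ⟨u, N⟩ hx
    rcases Nat.even_or_odd' N with ⟨M, rfl | rfl⟩
    · exact absurd ⟨(u - M, M), by simp⟩ hx
    · simp [shearTerm, altInvPochSum_two_mul_add_one]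
  have evens := (hinj.hasSum_iff hodd).2 (hasSum_shearTerm ε)
  have e : (shearTerm ε ∘ fun x : ℤ × ℕ ↦ ((x.1 + x.2, 2 * x.2) : ℤ × ℕ)) = fun x ↦
      (X ^ (2 * x.1.natAbs ^ 2) * sgn (ε ^ x.1)) *
        expand 2 two_ne_zero (eulerShiftTerm ε 0 x.2) :=
    funext fun x ↦ shearTerm_even ε x.1 x.2
  rw [e] at evens
  rw [(hasSum_mul (hasSum_theta ε two_ne_zero)
    (hasSum_expand 2 two_ne_zero (hasSum_eulerShift ε 0)) evens.summable).unique evens]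
  exact hasSum_tripleTerm_rows ε

/-- The sign `ε = -1` in `hasSum_eulerShift_mul_eulerShift`. -/
theorem theta_mul_eulerShift_sq :
    theta 1 1 * eulerShift (-1) 0 ^ 2 =
      theta (-1) 2 * expand 2 two_ne_zero (eulerShift (-1) 0) := by
  refine HasSum.unique ?_ (hasSum_eulerShift_mul_eulerShift (-1))
  have h := (hasSum_theta 1 one_ne_zero).mul_right (eulerShift (-1) 0 ^ 2)
  refine (congrArg (HasSum · _) (funext fun n ↦ ?_)).mp h
  rw [one_zpow, sgn_one, mul_one, one_mul]
  obtain ⟨m, rfl | rfl⟩ := n.eq_nat_or_neg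
  · have h1 := oddProd_mul_eulerShift (-1) m
    have h2 := sgn_pow_mul_eulerShift_neg (-1) m
    rw [zpow_natCast, Int.natAbs_natCast]
    linear_combination -eulerShift (-1) m * h2 - eulerShift (-1) 0 * h1
  · have h1 := oddProd_mul_eulerShift (-1) m
    have h2 := sgn_pow_mul_eulerShift_neg (-1) m
    rw [zpow_neg, zpow_natCast, Int.natAbs_neg, Int.natAbs_natCast, Int.units_inv_eq_self, neg_neg]
    linear_combination -eulerShift (-1) m * h2 - eulerShift (-1) 0 * h1

/-! ### Quadratic identities between theta series -/

theorem hasSum_of_isCompl_range {α β γ : Type*} {f : γ → ℤ⟦X⟧} {i : α → γ} {j : β → γ}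
    (hi : Function.Injective i) (hj : Function.Injective j) (hc : IsCompl (Set.range i) (Set.range j))
    {a b : ℤ⟦X⟧} (ha : HasSum (f ∘ i) a) (hb : HasSum (f ∘ j) b) : HasSum f (a + b) :=
  HasSum.add_isCompl hc (hi.hasSum_range_iff.2 ha) (hj.hasSum_range_iff.2 hb)

/-- The series `∑_{n ≥ 0} q^(n² + n)`, which is `ψ(q²)` in Ramanujan's notation. -/
noncomputable def psiSq : ℤ⟦X⟧ := ∑' n : ℕ, X ^ (n ^ 2 + n)

theorem hasSum_psiSq : HasSum (fun n : ℕ ↦ (X : ℤ⟦X⟧) ^ (n ^ 2 + n)) psiSq := by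
  have h := summable_X_pow_mul (fun n : ℕ ↦ n ^ 2 + n) (fun _ ↦ 1) fun d ↦
    (Set.finite_Iic d).subset fun n hn ↦ (Nat.le_add_left n (n ^ 2)).trans hn
  simp only [mul_one] at h
  exact h.hasSum

/-- The part of `∑_{n ∈ ℤ} q^(n²)` that comes from odd `n`. -/
noncomputable def thetaOdd : ℤ⟦X⟧ := 2 * X * expand 4 four_ne_zero psiSq

theorem hasSum_thetaOdd :
    HasSum (fun n : ℤ ↦ (X : ℤ⟦X⟧) ^ ((2 * n + 1).natAbs ^ 2)) thetaOdd := by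
  have h : HasSum (fun n : ℕ ↦ (X : ℤ⟦X⟧) ^ ((2 * (n : ℤ) + 1).natAbs ^ 2))
      (X * expand 4 four_ne_zero psiSq) := by
    refine (congrArg (HasSum · _) (funext fun n ↦ ?_)).mp
      ((hasSum_expand 4 four_ne_zero hasSum_psiSq).mul_left X)
    rw [map_pow, expand_X, ← pow_mul, ← pow_succ']
    congr 1
    zify
    rw [sq_abs]
    ring
  have h' : HasSum (fun n : ℕ ↦ (X : ℤ⟦X⟧) ^ ((2 * (-((n : ℤ) + 1)) + 1).natAbs ^ 2))
      (X * expand 4 four_ne_zero psiSq) := by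
    refine (congrArg (HasSum · _) (funext fun n ↦ ?_)).mp h
    rw [show 2 * (-((n : ℤ) + 1)) + 1 = -(2 * n + 1) by ring, Int.natAbs_neg]
  rw [thetaOdd, mul_assoc, two_mul]
  exact HasSum.of_nat_of_neg_add_one h h'

/-- The splitting of `φ(± q)` into even and odd parts. -/
theorem theta_one_eq (ε : ℤˣ) : theta ε 1 = theta 1 4 + sgn ε * thetaOdd := by
  have hi : Function.Injective fun n : ℤ ↦ 2 * n := fun a b h ↦ by simpa using h
  have hj : Function.Injective fun n : ℤ ↦ 2 * n + 1 := fun a b h ↦ by simpa using h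
  have hc : IsCompl (Set.range fun n : ℤ ↦ 2 * n) (Set.range fun n : ℤ ↦ 2 * n + 1) := by
    refine IsCompl.of_eq ?_ ?_
    · ext n
      simp only [Set.inf_eq_inter, Set.mem_inter_iff, Set.mem_range, Set.bot_eq_empty,
        Set.mem_empty_iff_false, iff_false]
      rintro ⟨⟨a, ha⟩, ⟨b, hb⟩⟩
      omega
    · ext n
      simp only [Set.sup_eq_union, Set.mem_union, Set.mem_range, Set.top_eq_univ, Set.mem_univ,
        iff_true]
      rcases Int.even_or_odd' n with ⟨m, h | h⟩
      · exact Or.inl ⟨m, h.symm⟩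
      · exact Or.inr ⟨m, h.symm⟩
  refine (hasSum_theta ε one_ne_zero).unique (hasSum_of_isCompl_range hi hj hc ?_ ?_)
  · refine (congrArg (HasSum · _) (funext fun n ↦ ?_)).mp (hasSum_theta 1 four_ne_zero)
    rw [Function.comp_apply, zpow_mul, zpow_ofNat, Int.units_sq, Int.natAbs_mul, mul_pow, one_mul,
      one_zpow]
    rfl
  · refine (congrArg (HasSum · _) (funext fun n ↦ ?_)).mp (hasSum_thetaOdd.mul_left (sgn ε))
    rw [Function.comp_apply, zpow_add, zpow_mul, zpow_ofNat, Int.units_sq, one_zpow, one_mul,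
      zpow_one, one_mul, mul_comm]

/-- The substitution `(a, b) ↦ (a + b, a - b)` in the double sum for `theta ε 2 ^ 2`. -/
theorem theta_two_sq (ε : ℤˣ) : theta ε 2 ^ 2 = theta 1 4 ^ 2 + sgn ε * thetaOdd ^ 2 := by
  have hi : Function.Injective fun x : ℤ × ℤ ↦ (x.1 + x.2, x.1 - x.2) := by
    rintro ⟨a, b⟩ ⟨c, d⟩ h
    simp only [Prod.mk.injEq] at h
    ext <;> simp only <;> omega
  have hj : Function.Injective fun x : ℤ × ℤ ↦ (x.1 + x.2 + 1, x.1 - x.2) := by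
    rintro ⟨a, b⟩ ⟨c, d⟩ h
    simp only [Prod.mk.injEq] at h
    ext <;> simp only <;> omega
  have hc : IsCompl (Set.range fun x : ℤ × ℤ ↦ (x.1 + x.2, x.1 - x.2))
      (Set.range fun x : ℤ × ℤ ↦ (x.1 + x.2 + 1, x.1 - x.2)) := by
    refine IsCompl.of_eq ?_ ?_
    · ext ⟨c, d⟩
      simp only [Set.inf_eq_inter, Set.mem_inter_iff, Set.mem_range, Set.bot_eq_empty,
        Set.mem_empty_iff_false, iff_false, Prod.mk.injEq]
      rintro ⟨⟨x, hx⟩, ⟨y, hy⟩⟩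
      omega
    · ext ⟨c, d⟩
      simp only [Set.sup_eq_union, Set.mem_union, Set.mem_range, Set.top_eq_univ, Set.mem_univ,
        iff_true, Prod.mk.injEq]
      rcases Int.even_or_odd' (c + d) with ⟨m, h | h⟩
      · exact Or.inl ⟨(m, m - d), by simp only; omega⟩
      · exact Or.inr ⟨(m, m - d), by simp only; omega⟩
  have fin : ∀ d : ℕ, {x : ℤ × ℤ | 2 * x.1.natAbs ^ 2 + 2 * x.2.natAbs ^ 2 ≤ d}.Finite := fun d ↦ by
    refine ((finite_mul_natAbs_sq_le two_ne_zero d).prod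
      (finite_mul_natAbs_sq_le two_ne_zero d)).subset fun x hx ↦ ?_
    simp only [Set.mem_prod, Set.mem_ofPred_eq] at hx ⊢
    omega
  have hs : Summable fun x : ℤ × ℤ ↦ (X ^ (2 * x.1.natAbs ^ 2) * sgn (ε ^ x.1)) *
      (X ^ (2 * x.2.natAbs ^ 2) * sgn (ε ^ x.2)) := by
    refine (congrArg Summable (funext fun x ↦ ?_)).mp
      (summable_X_pow_mul _ (fun x ↦ sgn (ε ^ x.1) * sgn (ε ^ x.2)) fin)
    rw [pow_add]
    ring
  have hsum := hasSum_mul (hasSum_theta ε two_ne_zero) (hasSum_theta ε two_ne_zero) hs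
  rw [sq]
  refine hsum.unique (hasSum_of_isCompl_range hi hj hc ?_ ?_)
  · have h := hasSum_mul (hasSum_theta 1 four_ne_zero) (hasSum_theta 1 four_ne_zero)
    rw [sq]
    have e : (fun x : ℤ × ℤ ↦ (X ^ (4 * x.1.natAbs ^ 2) * sgn (1 ^ x.1)) *
        (X ^ (4 * x.2.natAbs ^ 2) * sgn (1 ^ x.2))) = (fun x : ℤ × ℤ ↦
        (X ^ (2 * x.1.natAbs ^ 2) * sgn (ε ^ x.1)) * (X ^ (2 * x.2.natAbs ^ 2) * sgn (ε ^ x.2))) ∘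
        fun x : ℤ × ℤ ↦ (x.1 + x.2, x.1 - x.2) := by
      funext x
      have e1 : 4 * x.1.natAbs ^ 2 + 4 * x.2.natAbs ^ 2 =
          2 * (x.1 + x.2).natAbs ^ 2 + 2 * (x.1 - x.2).natAbs ^ 2 := by
        zify
        simp only [sq_abs]
        ring
      have e2 : sgn (ε ^ (x.1 + x.2)) * sgn (ε ^ (x.1 - x.2)) = 1 := by
        rw [← sgn_mul, ← zpow_add, show x.1 + x.2 + (x.1 - x.2) = 2 * x.1 by ring, zpow_mul,
          zpow_ofNat, Int.units_sq, one_zpow, sgn_one]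
      simp only [Function.comp_apply, one_zpow, sgn_one, mul_one]
      rw [← pow_add, e1, pow_add]
      linear_combination -X ^ (2 * (x.1 + x.2).natAbs ^ 2) * X ^ (2 * (x.1 - x.2).natAbs ^ 2) * e2
    rw [e] at h
    exact h (hs.comp_injective hi)
  · have h := hasSum_mul (hasSum_thetaOdd.mul_left (sgn ε)) hasSum_thetaOdd
    rw [sq, ← mul_assoc]
    have e : (fun x : ℤ × ℤ ↦ (sgn ε * X ^ ((2 * x.1 + 1).natAbs ^ 2)) *
        X ^ ((2 * x.2 + 1).natAbs ^ 2)) = (fun x : ℤ × ℤ ↦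
        (X ^ (2 * x.1.natAbs ^ 2) * sgn (ε ^ x.1)) * (X ^ (2 * x.2.natAbs ^ 2) * sgn (ε ^ x.2))) ∘
        fun x : ℤ × ℤ ↦ (x.1 + x.2 + 1, x.1 - x.2) := by
      funext x
      have e1 : (2 * x.1 + 1).natAbs ^ 2 + (2 * x.2 + 1).natAbs ^ 2 =
          2 * (x.1 + x.2 + 1).natAbs ^ 2 + 2 * (x.1 - x.2).natAbs ^ 2 := by
        zify
        simp only [sq_abs]
        ring
      have e2 : sgn (ε ^ (x.1 + x.2 + 1)) * sgn (ε ^ (x.1 - x.2)) = sgn ε := by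
        rw [← sgn_mul, ← zpow_add, show x.1 + x.2 + 1 + (x.1 - x.2) = 2 * x.1 + 1 by ring, zpow_add,
          zpow_mul, zpow_ofNat, Int.units_sq, one_zpow, one_mul, zpow_one]
      simp only [Function.comp_apply]
      rw [mul_assoc, ← pow_add, e1, pow_add]
      linear_combination -X ^ (2 * (x.1 + x.2 + 1).natAbs ^ 2) * X ^ (2 * (x.1 - x.2).natAbs ^ 2) * e2
    rw [e] at h
    exact h (hs.comp_injective hj)

/-- The identity `φ(q) φ(-q) = φ(-q²)²`. -/
theorem theta_mul_theta_neg : theta 1 1 * theta (-1) 1 = theta (-1) 2 ^ 2 := by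
  rw [theta_one_eq, theta_one_eq, theta_two_sq, sgn_neg, sgn_one]
  ring

/-- The identity `φ(q)² + φ(-q)² = 2 φ(q²)²`. -/
theorem theta_sq_add_theta_neg_sq : theta 1 1 ^ 2 + theta (-1) 1 ^ 2 = 2 * theta 1 2 ^ 2 := by
  rw [theta_one_eq, theta_one_eq, theta_two_sq, sgn_neg, sgn_one]
  ring

/-! ### Quotients of Euler series as quotients of theta series -/

theorem rescale_neg_one_expand_two (f : ℤ⟦X⟧) :
    rescale (-1 : ℤ) (expand 2 two_ne_zero f) = expand 2 two_ne_zero f := by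
  ext d
  rw [coeff_rescale]
  rcases Nat.even_or_odd d with h | h
  · rw [h.neg_one_pow, one_mul]
  · rw [coeff_expand_of_not_dvd, mul_zero]
    exact fun h2 ↦ (Nat.not_even_iff_odd.2 h) (even_iff_two_dvd.2 h2)

/-- The identity `(-q; q²)_∞ (q; q²)_∞ = (q²; q⁴)_∞`.  The squares of the two sides agree by
`theta_mul_eulerShift_sq`, its image under `q ↦ -q`, and `φ(q) φ(-q) = φ(-q²)²`. -/
theorem eulerShift_mul_eulerShift_neg :
    eulerShift 1 0 * eulerShift (-1) 0 = expand 2 two_ne_zero (eulerShift (-1) 0) := by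
  have h1 := theta_mul_eulerShift_sq
  have h2 := congrArg (rescale (-1 : ℤ)) h1
  have h3 : theta (-1) 2 = expand 2 two_ne_zero (theta (-1) 1) := by
    rw [expand_theta _ _ _ one_ne_zero, mul_one]
  rw [map_mul, map_pow, map_mul, rescale_neg_one_expand_two, rescale_neg_one_theta,
    rescale_neg_one_eulerShift_zero, neg_neg, h3, rescale_neg_one_expand_two, ← h3] at h2
  have h4 : theta (-1) 2 ^ 2 * (eulerShift 1 0 * eulerShift (-1) 0) ^ 2 =
      theta (-1) 2 ^ 2 * expand 2 two_ne_zero (eulerShift (-1) 0) ^ 2 := by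
    rw [← mul_pow _ (expand _ _ _), sq (theta (-1) 2 * _)]
    nth_rw 1 [← h1]
    rw [← h2, ← theta_mul_theta_neg]
    ring
  rcases sq_eq_sq_iff_eq_or_eq_neg.1 (mul_left_cancel₀
    (pow_ne_zero 2 (theta_ne_zero (-1) two_ne_zero)) h4) with h | h
  · exact h
  · have h5 := congrArg constantCoeff h
    rw [map_mul, map_neg, constantCoeff_expand, constantCoeff_eulerShift_zero,
      constantCoeff_eulerShift_zero] at h5
    norm_num at h5

/-- The quotient `(-q; q²)_∞ / (q; q²)_∞` equals `φ(q) / φ(-q²)`. -/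
theorem theta_mul_eulerShift_neg : theta 1 1 * eulerShift (-1) 0 = theta (-1) 2 * eulerShift 1 0 := by
  refine mul_right_cancel₀ (eulerShift_zero_ne_zero (-1)) ?_
  rw [mul_assoc, mul_assoc, ← sq, theta_mul_eulerShift_sq, eulerShift_mul_eulerShift_neg]

/-- The identity `S (q²; q⁴)_∞ = φ(q²) (-q²; q⁴)_∞` rewritten without infinite products. -/
theorem mul_theta_eq_of_mul_eulerShift_eq {S : ℤ⟦X⟧}
    (hS : S * (eulerShift 1 0 * eulerShift (-1) 0) =
      theta 1 2 * expand 2 two_ne_zero (eulerShift 1 0)) :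
    S * theta (-1) 4 = theta 1 2 ^ 2 := by
  have h := congrArg (expand 2 two_ne_zero) theta_mul_eulerShift_neg
  rw [map_mul, map_mul, expand_theta _ _ _ one_ne_zero, expand_theta _ _ _ two_ne_zero] at h
  rw [eulerShift_mul_eulerShift_neg] at hS
  have hne : expand 2 two_ne_zero (eulerShift (-1) 0) ≠ 0 := by
    rw [← eulerShift_mul_eulerShift_neg]
    exact mul_ne_zero (eulerShift_zero_ne_zero _) (eulerShift_zero_ne_zero _)
  refine mul_right_cancel₀ hne ?_
  linear_combination theta (-1) 4 * hS - theta 1 2 * h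

/-! ### The generating function of `v₀` -/

/-- The first `k` odd numbers. -/
def firstOdds (k : ℕ) : Finset ℕ :=
  (Finset.range k).map ⟨fun i ↦ 2 * i + 1, fun a b h ↦ by simpa using h⟩

theorem mem_firstOdds {k a : ℕ} : a ∈ firstOdds k ↔ ∃ i < k, 2 * i + 1 = a := by
  simp only [firstOdds, Finset.mem_map, Finset.mem_range]
  rfl

theorem two_mul_add_one_mem_firstOdds {k i : ℕ} : 2 * i + 1 ∈ firstOdds k ↔ i < k := by
  simp [mem_firstOdds]

theorem firstOdds_injective : Function.Injective firstOdds := fun k l h ↦ by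
  simpa [firstOdds] using congrArg Finset.card h

/-- The number of ways to overline a part size of multiplicity `c` so that a non-overlined copy of
it remains. -/
def overlineWeight (c : ℕ) : ℕ := if c = 0 then 0 else if c = 1 then 1 else 2

theorem overlineWeight_of_pos {c : ℕ} (hc : 0 < c) :
    overlineWeight c = if 2 ≤ c then 2 else 1 := by
  unfold overlineWeight
  split_ifs <;> omega

/-- The sum `∑_{c ≥ 1} overlineWeight c * q^c`. -/
noncomputable def weightSeries : ℤ⟦X⟧ := mk fun c ↦ (overlineWeight c : ℤ)

theorem weightSeries_mul_one_sub_X : weightSeries * (1 - X) = X * (1 + X) := by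
  ext n
  rw [mul_sub, mul_one, map_sub, mul_add, mul_one, map_add, ← sq, coeff_X, coeff_X_pow]
  rcases n with _ | _ | _ | n
  · simp [weightSeries, overlineWeight]
  · simp [weightSeries, overlineWeight, coeff_succ_mul_X]
  · simp [weightSeries, overlineWeight, coeff_succ_mul_X]
  · simp [weightSeries, overlineWeight, coeff_succ_mul_X]

/-- The generating function of the overpartitions that `v₀` counts with part sizes
`1, 3, …, 2k - 1`. -/
noncomputable def noGapsSeries (k : ℕ) : ℤ⟦X⟧ :=
  ∏ i ∈ Finset.range k, expand (2 * i + 1) (Nat.succ_ne_zero _) weightSeries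

theorem rescale_neg_one_oddProd (ε : ℤˣ) (m : ℕ) :
    rescale (-1 : ℤ) (oddProd ε m) = oddProd (-ε) m := by
  rw [oddProd, oddProd, map_prod]
  refine Finset.prod_congr rfl fun i _ ↦ ?_
  rw [map_add, map_one, map_mul, rescale_neg_one_sgn, rescale_neg_one_X_pow,
    (odd_two_mul_add_one i).neg_one_pow, sgn_neg, sgn_neg, sgn_one]
  ring

/-- The closed form `q^(k²) (-q; q²)ₖ / (q; q²)ₖ` of `noGapsSeries k`. -/
theorem noGapsSeries_mul_oddProd (k : ℕ) :
    noGapsSeries k * oddProd (-1) k = X ^ (k ^ 2) * oddProd 1 k := by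
  induction k with
  | zero => simp [noGapsSeries, oddProd]
  | succ k ih =>
    have h := congrArg (expand (2 * k + 1) (Nat.succ_ne_zero _)) weightSeries_mul_one_sub_X
    simp only [map_mul, map_sub, map_add, map_one, expand_X] at h
    rw [noGapsSeries, oddProd, oddProd, Finset.prod_range_succ, Finset.prod_range_succ,
      Finset.prod_range_succ, ← noGapsSeries, ← oddProd, ← oddProd, sgn_neg, sgn_one,
      show (k + 1) ^ 2 = k ^ 2 + (2 * k + 1) by ring, pow_add]
    linear_combination (1 - X ^ (2 * k + 1)) *
      expand (2 * k + 1) (Nat.succ_ne_zero _) weightSeries * ih + X ^ (k ^ 2) * oddProd 1 k * h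

namespace Overpartition

theorem mem_nonOverlined {n : ℕ} (p : Overpartition n) (b : ℕ) :
    b ∈ p.nonOverlined ↔
      b ∈ p.toPartition.parts ∧ (b ∈ p.overlined → 2 ≤ p.toPartition.parts.count b) := by
  rw [nonOverlined, ← Multiset.count_pos, ← Multiset.count_pos (s := p.toPartition.parts),
    Multiset.count_sub]
  by_cases hb : b ∈ p.overlined
  · rw [Multiset.count_eq_one_of_mem p.overlined.nodup hb]
    simp only [hb, true_imp_iff]
    omega
  · rw [Multiset.count_eq_zero_of_notMem (s := p.overlined.val) hb]
    simp [hb]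

/-- The overpartitions counted by `v₀` have part sizes `1, 3, …, 2k - 1`, and only repeated sizes can be
overlined. -/
theorem hasOddParts_and_hasNoGaps_iff {n : ℕ} (p : Overpartition n) :
    p.HasOddParts ∧ p.HasNoGaps ↔ (∃ k, p.toPartition.parts.toFinset = firstOdds k) ∧
      p.overlined ⊆ {a ∈ p.toPartition.parts.toFinset | 2 ≤ p.toPartition.parts.count a} := by
  constructor
  · rintro ⟨hodd, hgap⟩
    constructor
    · have hex : ∃ i, 2 * i + 1 ∉ p.toPartition.parts := by
        by_contra! h
        have := Finset.card_le_card (s := firstOdds (p.toPartition.parts.toFinset.card + 1))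
          (t := p.toPartition.parts.toFinset) fun a ha ↦ by
            obtain ⟨i, -, rfl⟩ := mem_firstOdds.1 ha
            exact Multiset.mem_toFinset.2 (h i)
        simp [firstOdds] at this
      refine ⟨Nat.find hex, ?_⟩
      ext a
      rw [Multiset.mem_toFinset, mem_firstOdds]
      constructor
      · intro ha
        obtain ⟨j, rfl⟩ := hodd a ha
        refine ⟨j, ?_, rfl⟩
        by_contra! hj
        exact Nat.find_spec hex
          ((p.mem_nonOverlined _).1 (hgap _ ha (2 * Nat.find hex + 1) (by omega) ⟨_, rfl⟩)).1
      · rintro ⟨i, hi, rfl⟩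
        exact not_not.1 (Nat.find_min hex hi)
    · intro b hb
      have hb' := p.overlined_subset hb
      exact Finset.mem_filter.2 ⟨hb', ((p.mem_nonOverlined b).1
        (hgap b (Multiset.mem_toFinset.1 hb') b le_rfl (hodd b (Multiset.mem_toFinset.1 hb')))).2 hb⟩
  · rintro ⟨⟨k, hk⟩, ho⟩
    have mem : ∀ a, a ∈ p.toPartition.parts ↔ ∃ i < k, 2 * i + 1 = a := fun a ↦ by
      rw [← Multiset.mem_toFinset, hk, mem_firstOdds]
    refine ⟨fun a ha ↦ ?_, fun a ha b hb hbo ↦ ?_⟩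
    · obtain ⟨i, -, rfl⟩ := (mem a).1 ha
      exact ⟨i, rfl⟩
    · obtain ⟨i, hi, rfl⟩ := (mem a).1 ha
      obtain ⟨j, rfl⟩ := hbo
      exact (p.mem_nonOverlined _).2
        ⟨(mem _).2 ⟨j, by omega, rfl⟩, fun h ↦ (Finset.mem_filter.1 (ho h)).2⟩

theorem card_overlined {n : ℕ} (p : n.Partition) :
    (Finset.univ.filter fun x : Overpartition n ↦
      (x.HasOddParts ∧ x.HasNoGaps) ∧ x.toPartition = p).card =
    open scoped Classical in if ∃ k, p.parts.toFinset = firstOdds k then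
      ∏ a ∈ p.parts.toFinset, overlineWeight (p.parts.count a) else 0 := by
  classical
  split_ifs with h
  · have hprod : ∏ a ∈ p.parts.toFinset, overlineWeight (p.parts.count a) =
        ({a ∈ p.parts.toFinset | 2 ≤ p.parts.count a}).powerset.card := by
      rw [Finset.card_powerset, ← Finset.prod_const, Finset.prod_filter]
      refine Finset.prod_congr rfl fun a ha ↦ ?_
      rw [overlineWeight_of_pos (Multiset.count_pos.2 (Multiset.mem_toFinset.1 ha))]
    rw [hprod]
    refine Finset.card_bij (fun x _ ↦ x.overlined) ?_ ?_ ?_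
    · intro x hx
      obtain ⟨hv, rfl⟩ := (Finset.mem_filter.1 hx).2
      exact Finset.mem_powerset.2 ((hasOddParts_and_hasNoGaps_iff x).1 hv).2
    · intro x hx y hy hxy
      exact Overpartition.ext
        ((Finset.mem_filter.1 hx).2.2.trans (Finset.mem_filter.1 hy).2.2.symm) hxy
    · intro o ho
      have ho := Finset.mem_powerset.1 ho
      exact ⟨⟨p, o, ho.trans (Finset.filter_subset _ _)⟩, Finset.mem_filter.2
        ⟨Finset.mem_univ _, (hasOddParts_and_hasNoGaps_iff _).2 ⟨h, ho⟩, rfl⟩, rfl⟩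
  · rw [Finset.card_eq_zero, Finset.filter_eq_empty_iff]
    rintro x - ⟨hx, rfl⟩
    exact h ((hasOddParts_and_hasNoGaps_iff x).1 hx).1

end Overpartition

open scoped Classical in
theorem v₀_eq_sum (n : ℕ) : v₀ n = ∑ p : n.Partition,
    if ∃ k, p.parts.toFinset = firstOdds k then
      ∏ a ∈ p.parts.toFinset, overlineWeight (p.parts.count a) else 0 := by
  rw [v₀, Fintype.card_subtype, Finset.card_eq_sum_card_fiberwise
    (f := Overpartition.toPartition) (t := Finset.univ) fun _ _ ↦ Finset.mem_coe.2 (Finset.mem_univ _)]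
  refine Finset.sum_congr rfl fun p _ ↦ ?_
  rw [Finset.filter_filter, Overpartition.card_overlined]

theorem coeff_noGapsSeries (n k : ℕ) : coeff n (noGapsSeries k) = ∑ p : n.Partition,
    if p.parts.toFinset = firstOdds k then
      ((∏ a ∈ p.parts.toFinset, overlineWeight (p.parts.count a) : ℕ) : ℤ) else 0 := by
  rw [noGapsSeries, coeff_prod, ← Finset.sum_filter]
  have hsupp : ∀ p : n.Partition, p.parts.toFinset = firstOdds k → ∀ i,
      i ∉ Finset.range k → p.parts.count (2 * i + 1) = 0 := fun p hp i hi ↦ by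
    rw [Multiset.count_eq_zero, ← Multiset.mem_toFinset, hp, two_mul_add_one_mem_firstOdds]
    simpa using hi
  -- the number of copies of `2i + 1`, times its size
  refine (Finset.sum_bij_ne_zero (fun p hp _ ↦ Finsupp.onFinset (Finset.range k)
    (fun i ↦ (2 * i + 1) * p.parts.count (2 * i + 1)) fun i hi ↦ ?_) ?_ ?_ ?_ ?_).symm
  · by_contra h
    exact hi (by rw [hsupp p (Finset.mem_filter.1 hp).2 i h, mul_zero])
  · intro p hp _
    refine Finset.mem_finsuppAntidiag.2 ⟨?_, Finsupp.support_onFinset_subset⟩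
    have h := p.parts_sum
    rw [← Multiset.map_id p.parts, Finset.sum_multiset_map_count, (Finset.mem_filter.1 hp).2,
      firstOdds, Finset.sum_map] at h
    refine Eq.trans (Finset.sum_congr rfl fun i _ ↦ ?_) h
    simp [mul_comm]
  · intro p hp _ q hq _ hpq
    have hp := (Finset.mem_filter.1 hp).2
    have hq := (Finset.mem_filter.1 hq).2
    refine Nat.Partition.ext (Multiset.ext.2 fun a ↦ ?_)
    by_cases ha : a ∈ firstOdds k
    · obtain ⟨i, -, rfl⟩ := mem_firstOdds.1 ha
      have h := DFunLike.congr_fun hpq i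
      simpa using h
    · rw [Multiset.count_eq_zero.2, Multiset.count_eq_zero.2]
      · rwa [← Multiset.mem_toFinset, hq]
      · rwa [← Multiset.mem_toFinset, hp]
  · intro l hl hne
    obtain ⟨hsum, hlsupp⟩ := Finset.mem_finsuppAntidiag.1 hl
    have hi : ∀ i ∈ Finset.range k, ∃ c, 0 < c ∧ l i = (2 * i + 1) * c := fun i hi ↦ by
      have h := Finset.prod_ne_zero_iff.1 hne i hi
      by_cases hd : 2 * i + 1 ∣ l i
      · obtain ⟨c, hc⟩ := hd
        refine ⟨c, Nat.pos_of_ne_zero ?_, hc⟩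
        rintro rfl
        rw [hc, coeff_expand_mul] at h
        exact h (by simp [weightSeries, overlineWeight])
      · exact absurd (coeff_expand_of_not_dvd _ _ _ hd) h
    choose! c hc hlc using hi
    have hcount : ∀ i, (∑ j ∈ Finset.range k, Multiset.replicate (c j) (2 * j + 1)).count
        (2 * i + 1) = if i ∈ Finset.range k then c i else 0 := fun i ↦ by
      rw [Multiset.count_sum']
      simp only [Multiset.count_replicate, Nat.add_right_cancel_iff]
      simp [Finset.sum_ite_eq']
    have hmem : ∀ a, a ∈ ∑ j ∈ Finset.range k, Multiset.replicate (c j) (2 * j + 1) ↔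
        a ∈ firstOdds k := fun a ↦ by
      rw [Multiset.mem_sum, mem_firstOdds]
      constructor
      · rintro ⟨i, hi, h⟩
        exact ⟨i, Finset.mem_range.1 hi, (Multiset.eq_of_mem_replicate h).symm⟩
      · rintro ⟨i, hi, rfl⟩
        exact ⟨i, Finset.mem_range.2 hi,
          Multiset.mem_replicate.2 ⟨(hc i (Finset.mem_range.2 hi)).ne', rfl⟩⟩
    have hp : (⟨∑ j ∈ Finset.range k, Multiset.replicate (c j) (2 * j + 1), fun {a} ha ↦ by
        obtain ⟨i, -, rfl⟩ := mem_firstOdds.1 ((hmem a).1 ha)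
        exact Nat.succ_pos _, by
        rw [Multiset.sum_sum, ← hsum]
        refine Finset.sum_congr rfl fun i hi ↦ ?_
        rw [hlc i hi, Multiset.sum_replicate, smul_eq_mul, mul_comm]⟩ : n.Partition).parts.toFinset =
        firstOdds k := by
      ext a
      rw [Multiset.mem_toFinset, hmem]
    refine ⟨_, Finset.mem_filter.2 ⟨Finset.mem_univ _, hp⟩, ?_, ?_⟩
    · rw [hp, Nat.cast_ne_zero, Finset.prod_ne_zero_iff]
      intro a ha
      rw [overlineWeight_of_pos (Multiset.count_pos.2 ((hmem a).2 ha))]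
      split_ifs <;> norm_num
    · ext i
      rw [Finsupp.onFinset_apply, hcount]
      split_ifs with h
      · rw [hlc i h]
      · rw [mul_zero, Finsupp.notMem_support_iff.1 fun h' ↦ h (hlsupp h')]
  · intro p hp _
    have hp' := (Finset.mem_filter.1 hp).2
    simp only [hp', firstOdds, Finset.prod_map, Nat.cast_prod]
    refine Finset.prod_congr rfl fun i _ ↦ ?_
    rw [Finsupp.onFinset_apply, coeff_expand_mul, weightSeries, coeff_mk]
    rfl

theorem hasSum_noGapsSeries : HasSum noGapsSeries (mk fun n ↦ (v₀ n : ℤ)) := by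
  classical
  rw [WithPiTopology.hasSum_iff_hasSum_coeff]
  intro n
  rw [coeff_mk, v₀_eq_sum, Nat.cast_sum]
  simp only [coeff_noGapsSeries]
  refine hasSum_sum fun p _ ↦ ?_
  split_ifs with h
  · obtain ⟨k, hk⟩ := h
    convert hasSum_single k fun l hl ↦ ?_ using 1
    · rw [if_pos hk]
    · rw [if_neg]
      exact fun h' ↦ hl (firstOdds_injective (h'.symm.trans hk))
  · convert hasSum_zero using 2 with k
    · rw [if_neg fun h' ↦ h ⟨k, h'⟩]
    · simp

/-- The identity `(V(q) + V(-q) - 1) φ(-q⁴) = φ(q²)²`, where `V(q) = ∑ v₀(n) qⁿ`.  The terms of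
`V(q)` and, shifted by one, those of `V(-q)` are the two halves of the bilateral sum. -/
theorem v₀_even_part_mul_theta :
    (mk (fun n ↦ (v₀ n : ℤ)) + rescale (-1 : ℤ) (mk fun n ↦ (v₀ n : ℤ)) - 1) * theta (-1) 4 =
      theta 1 2 ^ 2 := by
  refine mul_theta_eq_of_mul_eulerShift_eq (HasSum.unique ?_ (hasSum_eulerShift_mul_eulerShift 1))
  rw [add_sub_assoc, add_mul]
  refine HasSum.of_nat_of_neg_add_one ?_ ?_
  · refine (congrArg (HasSum · _) (funext fun m ↦ ?_)).mp (hasSum_noGapsSeries.mul_right _)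
    refine mul_right_cancel₀ (oddProd_ne_zero (-1) m) ?_
    have h1 := oddProd_mul_eulerShift (-1) m
    have h2 := sgn_pow_mul_eulerShift_neg 1 m
    have h3 := noGapsSeries_mul_oddProd m
    rw [one_pow, sgn_one, one_mul] at h2
    rw [one_zpow, sgn_one, one_mul, h2]
    linear_combination eulerShift 1 0 * eulerShift (-1) 0 * h3 - oddProd 1 m * eulerShift 1 0 * h1
  · have hs := (hasSum_nat_add_iff' 1).2 (hasSum_rescale (-1) hasSum_noGapsSeries)
    rw [Finset.sum_range_one, show noGapsSeries 0 = 1 by simp [noGapsSeries], map_one] at hs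
    refine (congrArg (HasSum · _) (funext fun m ↦ ?_)).mp (hs.mul_right _)
    have hm : (m : ℤ) + 1 = ((m + 1 : ℕ) : ℤ) := by push_cast; rfl
    rw [hm, neg_neg, one_zpow, sgn_one, one_mul]
    generalize m + 1 = m
    refine mul_right_cancel₀ (oddProd_ne_zero 1 m) ?_
    have h1 := oddProd_mul_eulerShift 1 m
    have h2 := sgn_pow_mul_eulerShift_neg (-1) m
    have h3 := congrArg (rescale (-1 : ℤ)) (noGapsSeries_mul_oddProd m)
    have h4 := neg_one_pow_natAbs_sq m
    rw [Int.natAbs_natCast, zpow_natCast] at h4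
    rw [map_mul, map_mul, rescale_neg_one_oddProd, rescale_neg_one_oddProd, rescale_neg_one_X_pow,
      neg_neg, h4] at h3
    linear_combination eulerShift 1 0 * eulerShift (-1) 0 * h3 -
      X ^ (m ^ 2) * eulerShift 1 0 * sgn ((-1) ^ m) * h2 +
      X ^ (m ^ 2) * eulerShift 1 0 * eulerShift (-1) (-m) * sgn_mul_self ((-1) ^ m) -
      eulerShift (-1) (-m) * h1

/-! ### Sections of power series -/

/-- The operator sending `∑ aₙ qⁿ` to `∑ a_{mn} qⁿ`. -/
noncomputable def dissect (m : ℕ) : ℤ⟦X⟧ →ₗ[ℤ] ℤ⟦X⟧ where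
  toFun f := mk fun n ↦ coeff (m * n) f
  map_add' f g := by ext; simp
  map_smul' c f := by
    ext n
    rw [RingHom.id_apply, map_zsmul, coeff_mk, coeff_mk, map_zsmul]

@[simp] theorem coeff_dissect (m n : ℕ) (f : ℤ⟦X⟧) :
    coeff n (dissect m f) = coeff (m * n) f := by
  simp [dissect]

theorem dissect_expand_mul {m : ℕ} (hm : m ≠ 0) (f g : ℤ⟦X⟧) :
    dissect m (expand m hm f * g) = f * dissect m g := by
  ext n
  rw [coeff_dissect, coeff_mul, coeff_mul]
  refine (Finset.sum_of_injOn (fun x : ℕ × ℕ ↦ (m * x.1, m * x.2)) ?_ ?_ ?_ ?_).symm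
  · rintro ⟨a, b⟩ - ⟨c, d⟩ - h
    simpa [hm] using h
  · rintro ⟨a, b⟩ h
    simp only [Finset.mem_coe, Finset.HasAntidiagonal.mem_antidiagonal] at h ⊢
    rw [← mul_add, h]
  · rintro ⟨a, b⟩ h hn
    rw [Finset.HasAntidiagonal.mem_antidiagonal] at h
    rw [coeff_expand_of_not_dvd, zero_mul]
    rintro ⟨c, rfl⟩
    obtain ⟨d, rfl⟩ : m ∣ b := (Nat.dvd_add_right (dvd_mul_right m c)).1 ⟨n, h⟩
    rw [← mul_add] at h
    exact hn ⟨(c, d), by simpa using Nat.eq_of_mul_eq_mul_left (Nat.pos_of_ne_zero hm) h, rfl⟩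
  · rintro ⟨a, b⟩ -
    rw [coeff_expand_mul, coeff_dissect]

theorem dissect_expand {m : ℕ} (hm : m ≠ 0) (f : ℤ⟦X⟧) : dissect m (expand m hm f) = f := by
  ext n
  rw [coeff_dissect, coeff_expand_mul]

theorem expand_injective {m : ℕ} (hm : m ≠ 0) :
    Function.Injective (expand m hm : ℤ⟦X⟧ → ℤ⟦X⟧) :=
  Function.LeftInverse.injective (dissect_expand hm)

theorem dissect_mul_X_pow {m : ℕ} (hm : m ≠ 0) (f : ℤ⟦X⟧) (b : ℕ) :
    dissect m (expand m hm f * X ^ b) = if m ∣ b then f * X ^ (b / m) else 0 := by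
  rw [dissect_expand_mul]
  split_ifs with h
  · obtain ⟨c, rfl⟩ := h
    rw [Nat.mul_div_cancel_left _ (Nat.pos_of_ne_zero hm), pow_mul, ← expand_X m hm, ← map_pow,
      dissect_expand]
  · have : dissect m (X ^ b) = 0 := by
      ext n
      rw [coeff_dissect, coeff_X_pow, if_neg fun h' ↦ h ⟨n, h'.symm⟩, map_zero]
    rw [this, mul_zero]

/-! ### The values of `v₀` at multiples of four -/

/-- The series `∑ (2 v₀(4n) - [n = 0]) qⁿ`. -/
noncomputable def quarterSeries : ℤ⟦X⟧ := mk fun n ↦ 2 * (v₀ (4 * n) : ℤ) - if n = 0 then 1 else 0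

/-- The even part of `φ(q)²` is `φ(q²)²`. -/
theorem dissect_two_theta_sq : dissect 2 (theta 1 1 ^ 2) = theta 1 1 ^ 2 := by
  have h1 : dissect 2 (theta (-1) 1 ^ 2) = dissect 2 (theta 1 1 ^ 2) := by
    ext n
    rw [← rescale_neg_one_theta, ← map_pow, coeff_dissect, coeff_dissect, coeff_rescale,
      (even_two_mul n).neg_one_pow, one_mul]
  have h2 := congrArg (dissect 2) theta_sq_add_theta_neg_sq
  have h3 : 2 * theta 1 2 ^ 2 = expand 2 two_ne_zero (2 * theta 1 1 ^ 2) := by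
    rw [map_mul, map_pow, expand_theta _ _ _ one_ne_zero, mul_one, map_ofNat]
  rw [map_add, h1, h3, dissect_expand, ← two_mul] at h2
  exact mul_left_cancel₀ (fun h ↦ by
    simpa only [map_ofNat, map_zero, OfNat.ofNat_ne_zero] using congrArg constantCoeff h) h2

/-- The identity `φ(-q) ∑ (2 v₀(4n) - [n = 0]) qⁿ = φ(q)²`. -/
theorem theta_neg_mul_quarterSeries : theta (-1) 1 * quarterSeries = theta 1 1 ^ 2 := by
  set W : ℤ⟦X⟧ := mk fun n ↦ 2 * (v₀ (2 * n) : ℤ) - if n = 0 then 1 else 0 with hW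
  have hS : mk (fun n ↦ (v₀ n : ℤ)) + rescale (-1 : ℤ) (mk fun n ↦ (v₀ n : ℤ)) - 1 =
      expand 2 two_ne_zero W := by
    ext d
    rw [map_sub, map_add, coeff_rescale, coeff_mk, coeff_one]
    rcases Nat.even_or_odd d with h | h
    · rw [h.neg_one_pow]
      obtain ⟨n, rfl⟩ := even_iff_two_dvd.1 h
      rw [coeff_expand_mul, hW, coeff_mk]
      simp only [mul_eq_zero, OfNat.ofNat_ne_zero, false_or]
      ring
    · rw [coeff_expand_of_not_dvd _ _ _ fun h2 ↦
        (Nat.not_even_iff_odd.2 h) (even_iff_two_dvd.2 h2), h.neg_one_pow, if_neg]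
      · ring
      · rintro rfl
        exact absurd h (by decide)
  have h2 : expand 2 two_ne_zero (theta (-1) 1) * W = theta 1 1 ^ 2 := by
    refine expand_injective two_ne_zero ?_
    have h := v₀_even_part_mul_theta
    rw [hS] at h
    rw [map_mul, map_pow, expand_theta _ _ _ one_ne_zero, expand_theta _ _ _ one_ne_zero,
      expand_theta _ _ _ (by norm_num), mul_comm]
    exact h
  have h3 := congrArg (dissect 2) h2
  rw [dissect_expand_mul, dissect_two_theta_sq] at h3
  convert h3 using 2
  ext n
  rw [quarterSeries, coeff_dissect, hW, coeff_mk, coeff_mk, ← mul_assoc]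
  simp

/-! ### The quartic section on polynomials in two theta series -/

/-- The fourth power of `φ(-q⁴)` is the form `P⁴ - Q⁴` in the even and odd parts of `φ(q)`. -/
theorem expand_four_theta_neg_pow_four :
    expand 4 four_ne_zero (theta (-1) 1) ^ 4 = theta 1 4 ^ 4 - thetaOdd ^ 4 := by
  have h := congrArg (expand 2 two_ne_zero) theta_mul_theta_neg
  rw [map_mul, map_pow, expand_theta _ _ _ one_ne_zero, expand_theta _ _ _ one_ne_zero,
    expand_theta _ _ _ two_ne_zero] at h
  have h1 := theta_two_sq 1
  have h2 := theta_two_sq (-1)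
  rw [sgn_neg, sgn_one] at h2
  rw [sgn_one] at h1
  rw [expand_theta _ _ _ one_ne_zero, show (4 : ℕ) * 1 = 2 * 2 by rfl]
  calc theta (-1) (2 * 2) ^ 4 = (theta (-1) (2 * 2) ^ 2) ^ 2 := by ring
    _ = theta 1 2 ^ 2 * theta (-1) 2 ^ 2 := by rw [← h, mul_one]; ring
    _ = _ := by rw [h1, h2]; ring

theorem theta_pow_four_sub : theta 1 1 ^ 4 - theta (-1) 1 ^ 4 = 16 * X * psiSq ^ 4 := by
  refine expand_injective four_ne_zero ?_
  rw [map_sub, map_pow, map_pow, expand_four_theta_neg_pow_four, expand_theta _ _ _ one_ne_zero,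
    mul_one, thetaOdd, map_mul, map_mul, map_pow, expand_X, map_ofNat]
  ring

theorem dissect_four_theta_mul_thetaOdd (a b : ℕ) :
    dissect 4 (theta 1 4 ^ a * thetaOdd ^ b) =
      if 4 ∣ b then theta 1 1 ^ a * (theta 1 1 ^ 4 - theta (-1) 1 ^ 4) ^ (b / 4) else 0 := by
  have h : theta 1 4 ^ a * thetaOdd ^ b =
      expand 4 four_ne_zero (theta 1 1 ^ a * (2 * psiSq) ^ b) * X ^ b := by
    rw [map_mul, map_pow, map_pow, map_mul, map_ofNat, expand_theta _ _ _ one_ne_zero, mul_one,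
      thetaOdd]
    ring
  rw [h, dissect_mul_X_pow]
  split_ifs with hb
  · obtain ⟨c, rfl⟩ := hb
    rw [Nat.mul_div_cancel_left _ (by norm_num), theta_pow_four_sub, pow_mul, mul_assoc, ← mul_pow]
    ring
  · rfl

/-- The reciprocal of `∑_{n ∈ ℤ} (-1)ⁿ q^(n²)`. -/
noncomputable def invThetaNeg : ℤ⟦X⟧ := invOfUnit (theta (-1) 1) 1

theorem theta_neg_mul_inv : theta (-1) 1 * invThetaNeg = 1 :=
  mul_invOfUnit _ _ (by rw [constantCoeff_theta _ one_ne_zero, Units.val_one])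

/-- The function `t = φ(q)⁴ / φ(-q)⁴ - 1`, where `φ(q) = ∑_{n ∈ ℤ} q^(n²)`. -/
noncomputable def hauptmodul : ℤ⟦X⟧ := 16 * X * psiSq ^ 4 * invThetaNeg ^ 4

theorem theta_neg_pow_four_mul_hauptmodul :
    theta (-1) 1 ^ 4 * hauptmodul = theta 1 1 ^ 4 - theta (-1) 1 ^ 4 := by
  rw [theta_pow_four_sub, hauptmodul]
  have h : theta (-1) 1 ^ 4 * invThetaNeg ^ 4 = 1 := by rw [← mul_pow, theta_neg_mul_inv, one_pow]
  linear_combination 16 * X * psiSq ^ 4 * h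

/-- The span of the series `φ tʲ` with `j ≥ 1`, where `t` is `hauptmodul`. -/
noncomputable def hauptSpan : Submodule ℤ ℤ⟦X⟧ :=
  Submodule.span ℤ {f | ∃ j, 1 ≤ j ∧ f = theta 1 1 * hauptmodul ^ j}

theorem theta_mul_hauptmodul_pow_mem (n : ℕ) {j : ℕ} (hj : 1 ≤ j) :
    theta 1 1 * hauptmodul ^ j * (1 + hauptmodul) ^ n ∈ hauptSpan := by
  induction n generalizing j with
  | zero =>
    rw [pow_zero, mul_one]
    exact Submodule.subset_span ⟨j, hj, rfl⟩
  | succ n ih =>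
    convert hauptSpan.add_mem (ih hj) (ih (Nat.le_add_right_of_le hj : 1 ≤ j + 1)) using 1
    ring

/-- The forms of degree `d` in the even and odd parts of the theta series, divisible by the `m`-th
power of the odd part. -/
noncomputable def formSpan (d m : ℕ) : Submodule ℤ ℤ⟦X⟧ :=
  Submodule.span ℤ {f | ∃ a b, a + b = d ∧ m ≤ b ∧ f = theta 1 4 ^ a * thetaOdd ^ b}

theorem formSpan_mul {d m d' m' : ℕ} {f g : ℤ⟦X⟧} (hf : f ∈ formSpan d m)
    (hg : g ∈ formSpan d' m') : f * g ∈ formSpan (d + d') (m + m') := by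
  induction hf, hg using Submodule.span_induction₂ with
  | mem_mem x y hx hy =>
    obtain ⟨a, b, rfl, hb, rfl⟩ := hx
    obtain ⟨a', b', rfl, hb', rfl⟩ := hy
    exact Submodule.subset_span ⟨a + a', b + b', by omega, by omega, by ring⟩
  | zero_left y hy => simp
  | zero_right x hx => simp
  | add_left x y z _ _ _ h₁ h₂ => simpa only [add_mul] using Submodule.add_mem _ h₁ h₂
  | add_right x y z _ _ _ h₁ h₂ => simpa only [mul_add] using Submodule.add_mem _ h₁ h₂
  | smul_left r x y _ _ h => simpa only [smul_mul_assoc] using Submodule.smul_mem _ r h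
  | smul_right r x y _ _ h => simpa only [mul_smul_comm] using Submodule.smul_mem _ r h

theorem formSpan_pow {d m : ℕ} {f : ℤ⟦X⟧} (hf : f ∈ formSpan d m) (k : ℕ) :
    f ^ k ∈ formSpan (k * d) (k * m) := by
  induction k with
  | zero => exact Submodule.subset_span ⟨0, 0, by simp, by simp, by simp⟩
  | succ k ih =>
    rw [pow_succ, Nat.succ_mul, Nat.succ_mul]
    exact formSpan_mul ih hf

/-- A monomial `φ^a (φ⁴ - φ(-q)⁴)^j` with `a + 4j = 16k + 1`, divided by `φ(-q)^(16k)`, is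
`φ (1 + t)^(4k-j) tʲ`. -/
theorem inv_pow_mul_dissect_mem {k : ℕ} {f : ℤ⟦X⟧} (hf : f ∈ formSpan (16 * k + 1) 1) :
    invThetaNeg ^ (16 * k) * dissect 4 f ∈ hauptSpan := by
  induction hf using Submodule.span_induction with
  | zero => simp
  | add x y _ _ hx hy =>
    rw [map_add, mul_add]
    exact hauptSpan.add_mem hx hy
  | smul c x _ hx =>
    rw [map_smul, mul_smul_comm]
    exact hauptSpan.smul_mem c hx
  | mem x hx =>
    obtain ⟨a, b, hab, hb, rfl⟩ := hx
    rw [dissect_four_theta_mul_thetaOdd]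
    split_ifs with h4
    · obtain ⟨j, rfl⟩ := h4
      rw [Nat.mul_div_cancel_left _ (by norm_num)]
      obtain ⟨i, hi⟩ : ∃ i, 4 * k = i + j := ⟨4 * k - j, by omega⟩
      obtain rfl : a = 1 + 4 * i := by omega
      have h1 : theta 1 1 ^ 4 = theta (-1) 1 ^ 4 * (1 + hauptmodul) := by
        linear_combination -theta_neg_pow_four_mul_hauptmodul
      have h2 : invThetaNeg ^ (16 * k) * (theta (-1) 1 ^ 4) ^ (i + j) = 1 := by
        rw [← pow_mul, ← hi, show 4 * (4 * k) = 16 * k by ring, ← mul_pow, mul_comm,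
          theta_neg_mul_inv, one_pow]
      convert theta_mul_hauptmodul_pow_mem i (j := j) (by omega) using 1
      rw [← theta_neg_pow_four_mul_hauptmodul, pow_add (theta 1 1), pow_mul (theta 1 1), h1, pow_one,
        mul_pow, mul_pow]
      linear_combination theta 1 1 * hauptmodul ^ j * (1 + hauptmodul) ^ i * h2
    · rw [mul_zero]
      exact hauptSpan.zero_mem

theorem theta_one_one_eq : theta 1 1 = theta 1 4 + thetaOdd := by
  rw [theta_one_eq, sgn_one, one_mul]

theorem theta_neg_one_eq : theta (-1) 1 = theta 1 4 - thetaOdd := by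
  rw [theta_one_eq, sgn_neg, sgn_one]
  ring

theorem expand_inv_mul_expand_theta :
    expand 4 four_ne_zero invThetaNeg * expand 4 four_ne_zero (theta (-1) 1) = 1 := by
  rw [← map_mul, mul_comm, theta_neg_mul_inv, map_one]

/-- The factor `8ᵏ` comes from `t φ(-q)⁴ = (P + Q)⁴ - (P - Q)⁴ = 8 P Q (P² + Q²)`. -/
theorem dissect_four_theta_mul_hauptmodul_pow {k : ℕ} (hk : 1 ≤ k) :
    ∃ g ∈ hauptSpan, dissect 4 (theta 1 1 * hauptmodul ^ k) = 8 ^ k * g := by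
  set P := theta 1 4 with hP
  set Q := thetaOdd with hQ
  set E := expand 4 four_ne_zero (theta (-1) 1) with hE
  set f := (P * Q) ^ k * ((P ^ 2 + Q ^ 2) ^ 5) ^ k * (((P + Q) ^ 4) ^ k * (P + Q)) with hf
  have hPm : P ∈ formSpan 1 0 := Submodule.subset_span ⟨1, 0, rfl, le_rfl, by simp [hP]⟩
  have hQm : Q ∈ formSpan 1 1 := Submodule.subset_span ⟨0, 1, rfl, le_rfl, by simp [hQ]⟩
  have hQm' : Q ∈ formSpan 1 0 := Submodule.subset_span ⟨0, 1, rfl, zero_le_one, by simp [hQ]⟩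
  have hfm : f ∈ formSpan (16 * k + 1) 1 := by
    have h := formSpan_mul (formSpan_mul (formSpan_pow (formSpan_mul hPm hQm) k)
      (formSpan_pow (formSpan_pow (Submodule.add_mem _ (formSpan_pow hPm 2)
        (formSpan_pow hQm' 2)) 5) k))
      (formSpan_mul (formSpan_pow (formSpan_pow (Submodule.add_mem _ hPm hQm') 4) k)
        (Submodule.add_mem _ hPm hQm'))
    refine Submodule.span_mono ?_ h
    rintro _ ⟨a, b, hab, hb, rfl⟩
    exact ⟨a, b, by omega, by omega, rfl⟩
  have hφ : theta 1 1 = P + Q := theta_one_one_eq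
  have h1 : hauptmodul * E ^ 16 = 8 * (P * Q * (P ^ 2 + Q ^ 2) ^ 5 * (P + Q) ^ 4) := by
    have h := theta_neg_pow_four_mul_hauptmodul
    rw [theta_one_one_eq, theta_neg_one_eq] at h
    rw [show E ^ 16 = (E ^ 4) ^ 4 by ring, hE, expand_four_theta_neg_pow_four]
    linear_combination ((P + Q) * (P ^ 2 + Q ^ 2)) ^ 4 * h
  have h2 : theta 1 1 * hauptmodul ^ k =
      expand 4 four_ne_zero (invThetaNeg ^ (16 * k)) * ((8 : ℤ) ^ k • f) := by
    have h3 : expand 4 four_ne_zero (invThetaNeg ^ (16 * k)) * (E ^ 16) ^ k = 1 := by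
      rw [map_pow, ← pow_mul, ← mul_pow, expand_inv_mul_expand_theta, one_pow]
    have h4 := congrArg (· ^ k) h1
    simp only [mul_pow (hauptmodul)] at h4
    rw [zsmul_eq_mul, Int.cast_pow, Int.cast_ofNat]
    calc theta 1 1 * hauptmodul ^ k
        = expand 4 four_ne_zero (invThetaNeg ^ (16 * k)) *
          (theta 1 1 * (hauptmodul ^ k * (E ^ 16) ^ k)) := by
          linear_combination -theta 1 1 * hauptmodul ^ k * h3
      _ = _ := by
          rw [h4, hφ, hf]
          simp only [mul_pow]
          ring
  refine ⟨_, inv_pow_mul_dissect_mem hfm, ?_⟩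
  rw [h2, dissect_expand_mul, map_smul, zsmul_eq_mul, Int.cast_pow, Int.cast_ofNat]
  ring

theorem dissect_four_of_mem_hauptSpan {f : ℤ⟦X⟧} (hf : f ∈ hauptSpan) :
    ∃ g ∈ hauptSpan, dissect 4 f = 8 * g := by
  induction hf using Submodule.span_induction with
  | zero => exact ⟨0, hauptSpan.zero_mem, by simp⟩
  | add x y _ _ hx hy =>
    obtain ⟨g, hg, hx⟩ := hx
    obtain ⟨g', hg', hy⟩ := hy
    exact ⟨g + g', hauptSpan.add_mem hg hg', by rw [map_add, hx, hy, mul_add]⟩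
  | smul c x _ hx =>
    obtain ⟨g, hg, hx⟩ := hx
    exact ⟨c • g, hauptSpan.smul_mem c hg, by rw [map_smul, hx, mul_smul_comm]⟩
  | mem x hx =>
    obtain ⟨j, hj, rfl⟩ := hx
    obtain ⟨g, hg, h⟩ := dissect_four_theta_mul_hauptmodul_pow hj
    obtain ⟨i, rfl⟩ := Nat.exists_eq_add_of_le' hj
    refine ⟨(8 : ℤ) ^ i • g, hauptSpan.smul_mem _ hg, ?_⟩
    rw [h, zsmul_eq_mul, Int.cast_pow, Int.cast_ofNat]
    ring

theorem dissect_four_theta : dissect 4 (theta 1 1) = theta 1 1 := by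
  have h1 := dissect_four_theta_mul_thetaOdd 1 0
  have h2 := dissect_four_theta_mul_thetaOdd 0 1
  norm_num at h1 h2
  conv_lhs => rw [theta_one_one_eq, map_add, h1, h2, add_zero]

/-- The series is `(P + Q)³ (P² + Q²) / φ(-q⁴)⁴`, with `P` and `Q` the even and odd parts of `φ(q)`. -/
theorem dissect_four_quarterSeries :
    dissect 4 quarterSeries = theta 1 1 + 4 * (theta 1 1 * hauptmodul) := by
  set P := theta 1 4 with hP
  set Q := thetaOdd with hQ
  have h1 : quarterSeries = expand 4 four_ne_zero (invThetaNeg ^ 4) *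
      (P ^ 5 * Q ^ 0 + (3 : ℤ) • (P ^ 4 * Q ^ 1) + (4 : ℤ) • (P ^ 3 * Q ^ 2) +
        (4 : ℤ) • (P ^ 2 * Q ^ 3) + (3 : ℤ) • (P ^ 1 * Q ^ 4) + P ^ 0 * Q ^ 5) := by
    have h := theta_neg_mul_quarterSeries
    rw [theta_one_one_eq, theta_neg_one_eq] at h
    have h2 : expand 4 four_ne_zero (invThetaNeg ^ 4) * (P ^ 4 - Q ^ 4) = 1 := by
      rw [map_pow, ← expand_four_theta_neg_pow_four, ← mul_pow, expand_inv_mul_expand_theta, one_pow]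
    simp only [zsmul_eq_mul, Int.cast_ofNat]
    linear_combination expand 4 four_ne_zero (invThetaNeg ^ 4) * (P + Q) * (P ^ 2 + Q ^ 2) * h -
      quarterSeries * h2
  have h2 : theta (-1) 1 ^ 4 * invThetaNeg ^ 4 = 1 := by rw [← mul_pow, theta_neg_mul_inv, one_pow]
  have h3 := theta_neg_pow_four_mul_hauptmodul
  rw [h1, dissect_expand_mul]
  simp only [map_add, map_smul, hP, hQ, dissect_four_theta_mul_thetaOdd]
  norm_num
  linear_combination (-4) * theta 1 1 * invThetaNeg ^ 4 * h3 +
    theta 1 1 * (4 * hauptmodul + 1) * h2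

theorem iterate_dissect_four_quarterSeries (β : ℕ) : ∃ g ∈ hauptSpan,
    (dissect 4)^[β + 1] quarterSeries = theta 1 1 + (2 : ℤ) ^ (3 * β + 2) • g := by
  induction β with
  | zero =>
    refine ⟨theta 1 1 * hauptmodul ^ 1, Submodule.subset_span ⟨1, le_rfl, rfl⟩, ?_⟩
    rw [zero_add, Function.iterate_one, dissect_four_quarterSeries, zsmul_eq_mul]
    norm_num
  | succ β ih =>
    obtain ⟨g, hg, h⟩ := ih
    obtain ⟨g', hg', h'⟩ := dissect_four_of_mem_hauptSpan hg
    refine ⟨g', hg', ?_⟩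
    rw [Function.iterate_succ_apply', h, map_add, map_smul, dissect_four_theta, h', zsmul_eq_mul,
      zsmul_eq_mul]
    push_cast
    ring

theorem sixteen_dvd_of_mem_hauptSpan {f : ℤ⟦X⟧} (hf : f ∈ hauptSpan) : 16 ∣ f := by
  induction hf using Submodule.span_induction with
  | zero => exact dvd_zero _
  | add x y _ _ hx hy => exact dvd_add hx hy
  | smul c x _ hx =>
    rw [zsmul_eq_mul]
    exact hx.mul_left _
  | mem x hx =>
    obtain ⟨j, hj, rfl⟩ := hx
    have h : (16 : ℤ⟦X⟧) ∣ hauptmodul :=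
      ⟨X * psiSq ^ 4 * invThetaNeg ^ 4, by rw [hauptmodul]; ring⟩
    exact (h.trans (dvd_pow_self _ (by omega))).mul_left _

theorem coeff_iterate_dissect (m k n : ℕ) (f : ℤ⟦X⟧) :
    coeff n ((dissect m)^[k] f) = coeff (m ^ k * n) f := by
  induction k generalizing n with
  | zero => simp
  | succ k ih => rw [Function.iterate_succ_apply', coeff_dissect, ih, pow_succ, mul_assoc]

theorem hasSum_theta_add_one : HasSum (fun n : ℕ ↦ 2 * (X : ℤ⟦X⟧) ^ (n ^ 2)) (theta 1 1 + 1) := by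
  have hs := summable_X_pow_mul (fun n : ℕ ↦ n ^ 2) (fun _ ↦ 1) fun d ↦
    (Set.finite_Iic d).subset fun n hn ↦ (Nat.le_self_pow two_ne_zero n).trans hn
  simp only [mul_one] at hs
  have h1 := hs.hasSum
  have h2 := (hasSum_nat_add_iff' 1).2 h1
  have h : HasSum (fun n : ℤ ↦ (X : ℤ⟦X⟧) ^ (1 * n.natAbs ^ 2) * sgn (1 ^ n))
      ((∑' n : ℕ, (X : ℤ⟦X⟧) ^ (n ^ 2)) +
        ((∑' n : ℕ, (X : ℤ⟦X⟧) ^ (n ^ 2)) - ∑ n ∈ Finset.range 1, (X : ℤ⟦X⟧) ^ (n ^ 2))) := by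
    refine HasSum.of_nat_of_neg_add_one ?_ ?_
    · simpa only [one_mul, one_zpow, sgn_one, mul_one, Int.natAbs_natCast] using h1
    · simp only [one_mul, one_zpow, sgn_one, mul_one, Int.natAbs_neg]
      exact h2
  rw [(hasSum_theta 1 one_ne_zero).unique h]
  have e : (∑' n : ℕ, (X : ℤ⟦X⟧) ^ (n ^ 2)) +
      ((∑' n : ℕ, (X : ℤ⟦X⟧) ^ (n ^ 2)) - ∑ n ∈ Finset.range 1, (X : ℤ⟦X⟧) ^ (n ^ 2)) + 1 =
      2 * ∑' n : ℕ, (X : ℤ⟦X⟧) ^ (n ^ 2) := by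
    rw [Finset.sum_range_one]
    ring
  rw [e]
  exact h1.mul_left 2

open scoped Classical in
theorem coeff_theta_add (n : ℕ) : coeff n (theta 1 1) + (if n = 0 then 1 else 0) =
    2 * if IsSquare n then 1 else 0 := by
  have h := (WithPiTopology.hasSum_iff_hasSum_coeff ℤ).1 hasSum_theta_add_one n
  rw [map_add, coeff_one] at h
  refine h.unique ?_
  split_ifs with hn
  · obtain ⟨k, rfl⟩ := hn
    convert hasSum_single k fun l hl ↦ ?_ using 1
    · rw [← sq, ← map_ofNat C 2, coeff_C_mul, coeff_X_pow_self]
    · rw [← sq, ← map_ofNat C 2, coeff_C_mul, coeff_X_pow, if_neg, mul_zero]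
      exact fun h ↦ hl (Nat.pow_left_injective two_ne_zero h).symm
  · convert hasSum_zero using 2 with k
    · rw [← map_ofNat C 2, coeff_C_mul, coeff_X_pow, if_neg, mul_zero]
      rintro rfl
      exact hn ⟨k, sq k⟩
    · simp

open scoped Classical in
theorem v₀_modEq (n β : ℕ) : (v₀ (4 ^ (β + 2) * n) : ℤ) ≡ (if IsSquare n then 1 else 0)
    [ZMOD 2 ^ (3 * β + 5)] := by
  obtain ⟨g, hg, h⟩ := iterate_dissect_four_quarterSeries β
  obtain ⟨f, rfl⟩ := sixteen_dvd_of_mem_hauptSpan hg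
  have hc := congrArg (coeff n) h
  have hn : 4 ^ (β + 1) * n = 0 ↔ n = 0 := by simp
  rw [coeff_iterate_dissect, quarterSeries, coeff_mk, map_add, map_smul, ← map_ofNat C 16,
    coeff_C_mul, smul_eq_mul, ← mul_assoc, ← pow_succ'] at hc
  simp only [hn] at hc
  have ht := coeff_theta_add n
  refine (Int.modEq_iff_dvd.2 ⟨coeff n f, ?_⟩).symm
  have h2 : (2 : ℤ) ^ (3 * β + 5) = 8 * 2 ^ (3 * β + 2) := by ring
  rw [h2]
  have h16 : (OfNat.ofNat 16 : ℤ) = 16 := rfl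
  rw [h16] at hc
  linarith

end

theorem mainTheorem1 (n α : ℕ) (hα : 1 ≤ α) :
    (IsSquare n → v₀ (2 ^ (2 * α + 2) * n) ≡ 1 [MOD 2 ^ (3 * α + 2)]) ∧
    (¬ IsSquare n → v₀ (2 ^ (2 * α + 2) * n) ≡ 0 [MOD 2 ^ (3 * α + 2)]) := by
  obtain ⟨β, rfl⟩ := Nat.exists_eq_add_of_le' hα
  have h := v₀_modEq n β
  rw [show (4 : ℕ) = 2 ^ 2 by rfl, ← pow_mul, show 2 * (β + 2) = 2 * (β + 1) + 2 by ring,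
    show 3 * β + 5 = 3 * (β + 1) + 2 by ring] at h
  refine ⟨fun hn ↦ ?_, fun hn ↦ ?_⟩
  · rw [if_pos hn] at h
    exact (Int.natCast_modEq_iff).1 (by exact_mod_cast h)
  · rw [if_neg hn] at h
    exact (Int.natCast_modEq_iff).1 (by exact_mod_cast h)
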